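/- Let $\mathfrak g$ be a finite-dimensional complex simple Lie algebra with Killing form $(\cdot,\cdot)$ and Cartan subalgebra $\mathfrak h_{\mathbb C}$, which is identified with its dual by means of $(\cdot,\cdot)$, and let $\mathfrak h\subset\mathfrak h_{\mathbb C}$ be the real span of the set $\Delta$ of roots. Fix positive roots $\Delta_+$ with simple roots $\alpha_1,\dots,\alpha_\ell$; let $\psi$ be the highest root, $\rho=\tfrac12\sum_{\varphi\in\Delta_+}\varphi$, and $\varphi^\vee=2\varphi/(\varphi,\varphi)$ for $\varphi\in\Delta$. Let $\Gamma\subset\mathfrak h$ be the lattice generated by the coroots $\varphi^\vee$, let $W$ be the Weyl group, and let $W_f=\Gamma\rtimes W$ be the affine Weyl group acting on $\mathfrak h$, with Coxeter generators the reflections in the walls $(\alpha_i,x)=0$ ($1\le i\le\ell$) and $(\psi,x)=1$, and with length function $\sigma\mapsto\ell(\sigma)$ relative to these generators. Put $$\mathfrak h^+=\{x\in\mathfrak h\mid(\varphi,x)\ge 0\ \ \forall\varphi\in\Delta_+\},\qquad \mathfrak h^{(2)}=\{x\in\mathfrak h^+\mid(\psi,x)\le 2\},$$ $$A_1=\{x\in\mathfrak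 h\mid(\alpha_i,x)\ge 0\ \ \forall i,\ (\psi,x)\le 1\},\qquad A_\sigma=\sigma(A_1)\quad(\sigma\in W_f),$$ $$W_f^+=\{\sigma\in W_f\mid A_\sigma\subset\mathfrak h^+\},\qquad W_f^{(2)}=\{\sigma\in W_f^+\mid A_\sigma\subset\mathfrak h^{(2)}\}.$$ For $\sigma\in W_f^+$ let $\lambda^\sigma=\tfrac12\sigma(2\rho)-\rho$. For $\lambda\in\mathfrak h$ let $\mathrm{Cas}(\lambda)=(\lambda+\rho,\lambda+\rho)-(\rho,\rho)$. Let $\mathfrak b$ be the Borel subalgebra spanned by $\mathfrak h_{\mathbb C}$ and the root vectors $e_\varphi$, $\varphi\in\Delta_+$, and for an abelian ideal $\mathfrak a$ of $\mathfrak b$ let $\lambda_{\mathfrak a}$ be the sum of all roots $\varphi$ with $e_\varphi\in\mathfrak a$. **Theorem.** Let $\sigma\in W_f^+$. 1. On every finite-dimensional irreducible $\mathfrak g$-module with highest weight $\lambda^\sigma$, the Casimir element of $U(\mathfrak g)$ relative to the Killing form acts as the scalar $\mathrm{Cas}(\lambda^\sigma)$. 2. $\mathrm{Cas}(\lambda^\sigma)\ge\ell(\sigma)$.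 3. $\mathrm{Cas}(\lambda^\sigma)=\ell(\sigma)$ if and only if $\sigma\in W_f^{(2)}$. 4. If $\sigma\in W_f^{(2)}$, then there is exactly one abelian ideal $\mathfrak a$ of $\mathfrak b$ with $\lambda_{\mathfrak a}=\lambda^\sigma$, and for it $$\mathrm{Cas}(\lambda^\sigma)=\ell(\sigma)=\dim_{\mathbb C}\mathfrak a.$$ -/

import Mathlib

noncomputable section

namespace Alcove

section

open LieAlgebra LieAlgebra.IsKilling LieModule

variable {𝔤 : Type*} [LieRing 𝔤] [LieAlgebra ℂ 𝔤] [FiniteDimensional ℂ 𝔤] [IsSimple ℂ 𝔤]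
variable (H : LieSubalgebra ℂ 𝔤) [H.IsCartanSubalgebra]

/-- The real form `𝔥` of the Cartan subalgebra `H`: the real span of the roots, each root being
regarded as an element of `H` by means of the Killing form. -/
def realCartan : Submodule ℝ H :=
  Submodule.span ℝ (Set.range fun α : H.root => (cartanEquivDual H).symm α.1.toLinear)

variable {H}

/-- A root, as an element of `𝔥`. -/
def rootVec (α : H.root) : realCartan H :=
  ⟨(cartanEquivDual H).symm α.1.toLinear, Submodule.subset_span ⟨α, rfl⟩⟩

lemma killingForm_rootVec (α : H.root) (h : H) :
    killingForm ℂ 𝔤 ((rootVec α : H) : 𝔤) (h : 𝔤) = α.1 h :=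
  LinearMap.BilinForm.apply_toDual_symm_apply (hB := traceForm_cartan_nondegenerate ℂ 𝔤 H) _ _

lemma coroot_eq (α : H.root) :
    IsKilling.coroot α.1 = (2 * (α.1 (rootVec α : H))⁻¹) • (rootVec α : H) := by
  rw [IsKilling.coroot, rootVec, mul_smul, ← Nat.cast_smul_eq_nsmul ℂ]
  simp

lemma apply_rootVec_self_ne (α : H.root) : α.1 (rootVec α : H) ≠ 0 :=
  root_apply_cartanEquivDual_symm_ne_zero (LieSubalgebra.isNonZero_coe_root α)

lemma exists_apply_rootVec_self (α : H.root) : ∃ q : ℝ, 0 < q ∧ α.1 (rootVec α : H) = q := by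
  set c := α.1 (rootVec α : H) with hc
  have hc0 : c ≠ 0 := apply_rootVec_self_ne α
  let f : H.root → ℤ := fun γ => chainBotCoeff α.1 γ.1 - chainTopCoeff α.1 γ.1
  have hf : ∀ γ : H.root, γ.1 (IsKilling.coroot α.1) = f γ := fun γ => by
    exact apply_coroot_eq_cast α.1 γ.1
  have h1 : killingForm ℂ 𝔤 (IsKilling.coroot α.1 : H) (IsKilling.coroot α.1 : H) =
      ((∑ γ : H.root, f γ ^ 2 : ℤ) : ℂ) := by
    have := congrArg (fun B => B (IsKilling.coroot α.1) (IsKilling.coroot α.1))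
      (restrict_killingForm_eq_sum (K := ℂ) (L := 𝔤) (H := H))
    simp only [LinearMap.BilinForm.restrict_apply, LinearMap.sum_apply,
      LinearMap.smulRight_apply, LinearMap.smul_apply] at this
    rw [← Finset.sum_coe_sort] at this
    refine Eq.trans this ?_
    push_cast
    refine Finset.sum_congr rfl fun γ _ => ?_
    have h : Weight.toLinear ℂ H 𝔤 γ.1 (IsKilling.coroot α.1) = f γ := hf γ
    rw [sq, ← h]
    rfl
  have h2 : killingForm ℂ 𝔤 (IsKilling.coroot α.1 : H) (IsKilling.coroot α.1 : H) = 4 * c⁻¹ := by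
    rw [coroot_eq α]
    have h3 : killingForm ℂ 𝔤 ((rootVec α : H) : 𝔤) ((rootVec α : H) : 𝔤) = c :=
      killingForm_rootVec α _
    simp only [SetLike.val_smul, map_smul, LinearMap.smul_apply, smul_eq_mul, h3, ← hc]
    field_simp
    norm_num
  have hpos : 0 < ∑ γ : H.root, f γ ^ 2 := by
    refine Finset.sum_pos' (fun _ _ => sq_nonneg _) ⟨α, Finset.mem_univ _, ?_⟩
    have : (f α : ℂ) = 2 := by
      rw [← hf, root_apply_coroot (LieSubalgebra.isNonZero_coe_root α)]
    have : f α = 2 := by exact_mod_cast this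
    simp [this]
  set n := ∑ γ : H.root, f γ ^ 2
  refine ⟨4 / n, by positivity, ?_⟩
  have hn : (n : ℂ) ≠ 0 := by exact_mod_cast hpos.ne'
  rw [h1] at h2
  push_cast
  field_simp at h2 ⊢
  linear_combination h2

lemma exists_apply_rootVec (α β : H.root) : ∃ q : ℝ, α.1 (rootVec β : H) = q := by
  obtain ⟨q, hq, h⟩ := exists_apply_rootVec_self β
  have h1 := apply_coroot_eq_cast β.1 α.1
  rw [coroot_eq β, h] at h1
  refine ⟨(chainBotCoeff β.1 α.1 - chainTopCoeff β.1 α.1 : ℤ) * q / 2, ?_⟩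
  have hq' : (q : ℂ) ≠ 0 := by exact_mod_cast hq.ne'
  have h2 : α.1 ((2 * (q : ℂ)⁻¹) • (rootVec β : H)) =
      (2 * (q : ℂ)⁻¹) * α.1 (rootVec β : H) := by
    exact (α.1.toLinear).map_smul (2 * (q : ℂ)⁻¹) (rootVec β : H)
  rw [h2] at h1
  push_cast at h1 ⊢
  field_simp at h1 ⊢
  linear_combination h1

variable (H) in
/-- The Killing form on `𝔥`. It is real valued there, see `coe_killForm`. -/
def killForm : LinearMap.BilinForm ℝ (realCartan H) :=
  LinearMap.mk₂ ℝ (fun x y => (killingForm ℂ 𝔤 ((x : H) : 𝔤) ((y : H) : 𝔤)).re)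
    (by intros; simp) (by intros; simp [← Complex.coe_smul])
    (by intros; simp) (by intros; simp [← Complex.coe_smul])

lemma coe_killForm (x y : realCartan H) :
    (killForm H x y : ℂ) = killingForm ℂ 𝔤 ((x : H) : 𝔤) ((y : H) : 𝔤) := by
  have key : ∀ x ∈ realCartan H, ∀ y ∈ realCartan H,
      (killingForm ℂ 𝔤 (x : 𝔤) (y : 𝔤)).im = 0 := by
    intro x hx y hy
    induction hx using Submodule.span_induction with
    | mem x hx =>
      obtain ⟨α, rfl⟩ := hx
      induction hy using Submodule.span_induction with
      | mem y hy =>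
        obtain ⟨β, rfl⟩ := hy
        obtain ⟨q, hq⟩ := exists_apply_rootVec α β
        have := killingForm_rootVec α (rootVec β : H)
        rw [hq] at this
        exact (congrArg Complex.im this).trans (Complex.ofReal_im q)
      | zero => simp
      | add _ _ _ _ h1 h2 => simp [h1, h2]
      | smul a _ _ h => simp [← Complex.coe_smul, h]
    | zero => simp
    | add _ _ _ _ h1 h2 => simp [h1, h2]
    | smul a _ _ h => simp [← Complex.coe_smul, h]
  exact Complex.ext rfl (key _ x.2 _ y.2).symm

lemma killForm_rootVec_self_pos (α : H.root) : 0 < killForm H (rootVec α) (rootVec α) := by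
  obtain ⟨q, hq, h⟩ := exists_apply_rootVec_self α
  have := coe_killForm (rootVec α) (rootVec α)
  rw [killingForm_rootVec, h] at this
  rwa [Complex.ofReal_injective this]

/-- `φ^∨ = 2φ/(φ,φ)`, as an element of `𝔥`. -/
def corootVec (α : H.root) : realCartan H :=
  (2 / killForm H (rootVec α) (rootVec α)) • rootVec α

lemma killForm_rootVec_corootVec (α : H.root) : killForm H (rootVec α) (corootVec α) = 2 := by
  have := (killForm_rootVec_self_pos α).ne'
  simp only [corootVec, map_smul, smul_eq_mul]
  field_simp

/-- The reflection `s_φ : x ↦ x - (φ,x) φ^∨` of `𝔥`. -/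
def rootReflection (α : H.root) : realCartan H ≃ₗ[ℝ] realCartan H :=
  Module.reflection (killForm_rootVec_corootVec α)

/-- The affine reflection `s_{φ,n} : x ↦ s_φ(x) + n φ^∨` in the wall `(φ,x) = n`. -/
def affineReflection (α : H.root) (n : ℤ) : realCartan H ≃ᵃ[ℝ] realCartan H :=
  AffineEquiv.constVAdd ℝ (realCartan H) (n • corootVec α) * (rootReflection α).toAffineEquiv

variable (H)

/-- The Weyl group `W`, acting on `𝔥`. -/
def weylGroup : Subgroup (realCartan H ≃ᵃ[ℝ] realCartan H) :=
  Subgroup.closure (Set.range fun α : H.root => (rootReflection α).toAffineEquiv)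

/-- The lattice `Γ` in `𝔥` generated by the coroots. -/
def corootLattice : AddSubgroup (realCartan H) :=
  AddSubgroup.closure (Set.range (corootVec (H := H)))

/-- The group of translations of `𝔥` by elements of `Γ`. -/
def translationGroup : Subgroup (realCartan H ≃ᵃ[ℝ] realCartan H) :=
  (AddSubgroup.toSubgroup (corootLattice H)).map (AffineEquiv.constVAddHom ℝ (realCartan H))

/-- The affine Weyl group `W_f`: the group of affine transformations of `𝔥` generated by `W` and
by the translations by `Γ` (the latter are normalized by `W`). -/
def affineWeylGroup : Subgroup (realCartan H ≃ᵃ[ℝ] realCartan H) :=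
  translationGroup H ⊔ weylGroup H

variable {H} (b : (rootSystem H).Base)

lemma nonempty_root : Nonempty H.root := by
  have := RootPairing.IsIrreducible.nontrivial (rootSystem H)
  by_contra h
  rw [not_nonempty_iff] at h
  have h1 := RootPairing.IsRootSystem.span_root_eq_top (P := rootSystem H)
  rw [Set.range_eq_empty, Submodule.span_empty] at h1
  exact bot_ne_top h1

/-- The highest root `ψ`: the root of greatest height (it is unique, as `𝔤` is simple). -/
def highestRoot : H.root :=
  Classical.choose (haveI := nonempty_root (H := H); Finite.exists_max b.height)

/-- `ρ`, one half of the sum of the positive roots. -/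
def rho : realCartan H :=
  open Classical in (1 / 2 : ℝ) • ∑ α : H.root with b.IsPos α, rootVec α

/-- The Weyl chamber `𝔥⁺`. -/
def chamber : Set (realCartan H) :=
  {x | ∀ α : H.root, b.IsPos α → 0 ≤ killForm H (rootVec α) x}

/-- `𝔥^{(k)}`, the part of the Weyl chamber where `(ψ,x) ≤ k`. -/
def truncatedChamber (k : ℕ) : Set (realCartan H) :=
  {x | x ∈ chamber b ∧ killForm H (rootVec (highestRoot b)) x ≤ k}

/-- The fundamental alcove `A₁`. -/
def fundamentalAlcove : Set (realCartan H) :=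
  {x | (∀ α ∈ b.support, 0 ≤ killForm H (rootVec α) x) ∧
    killForm H (rootVec (highestRoot b)) x ≤ 1}

/-- The alcove `A_σ = σ(A₁)`. -/
def alcove (σ : realCartan H ≃ᵃ[ℝ] realCartan H) : Set (realCartan H) :=
  σ '' fundamentalAlcove b

/-- `W_f⁺`, the set of those `σ` in `W_f` whose alcove lies in the Weyl chamber. -/
def dominantElements : Set (realCartan H ≃ᵃ[ℝ] realCartan H) :=
  {σ | σ ∈ affineWeylGroup H ∧ alcove b σ ⊆ chamber b}

/-- `W_f^{(k)}`, the set of those `σ` in `W_f⁺` whose alcove lies in `𝔥^{(k)}`. -/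
def truncatedElements (k : ℕ) : Set (realCartan H ≃ᵃ[ℝ] realCartan H) :=
  {σ | σ ∈ dominantElements b ∧ alcove b σ ⊆ truncatedChamber b k}

/-- The Coxeter generators of `W_f`: the reflections in the simple roots, together with
`s_{ψ,1}`. -/
def coxeterGenerators : Set (realCartan H ≃ᵃ[ℝ] realCartan H) :=
  {s | (∃ α ∈ b.support, s = affineReflection α 0) ∨ s = affineReflection (highestRoot b) 1}

/-- The length `ℓ(σ)` of an element `σ` of `W_f`: the least number of Coxeter generators having
`σ` as their product. -/
def length (σ : realCartan H ≃ᵃ[ℝ] realCartan H) : ℕ :=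
  sInf {n | ∃ l : List (realCartan H ≃ᵃ[ℝ] realCartan H),
    (∀ s ∈ l, s ∈ coxeterGenerators b) ∧ l.prod = σ ∧ l.length = n}

/-- `λ^σ = σ(2ρ)/2 - ρ`. -/
def alcoveWeight (σ : realCartan H ≃ᵃ[ℝ] realCartan H) : realCartan H :=
  (1 / 2 : ℝ) • σ ((2 : ℝ) • rho b) - rho b

/-- `Cas(λ) = (λ+ρ,λ+ρ) - (ρ,ρ)`, the scalar by which the Casimir element acts on the irreducible
`𝔤`-module with highest weight `λ`. -/
def cas (μ : realCartan H) : ℝ :=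
  killForm H (μ + rho b) (μ + rho b) - killForm H (rho b) (rho b)

variable (𝔤) in
/-- The Casimir element `∑ xᵢ xⁱ` of the universal enveloping algebra, for a basis `(xᵢ)` of `𝔤`
and the basis `(xⁱ)` dual to it under the Killing form. -/
def casimirElement : UniversalEnvelopingAlgebra ℂ 𝔤 :=
  ∑ i, UniversalEnvelopingAlgebra.ι ℂ (Module.finBasis ℂ 𝔤 i) *
    UniversalEnvelopingAlgebra.ι ℂ ((killingForm ℂ 𝔤).dualBasis
      (IsKilling.killingForm_nondegenerate ℂ 𝔤) (Module.finBasis ℂ 𝔤) i)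

/-- The `𝔤`-module `V` has a highest weight vector of weight `μ`, where `μ ∈ 𝔥` stands for the
linear form `h ↦ (μ,h)` on `H`. -/
def HasHighestWeight (V : Type*) [AddCommGroup V] [Module ℂ V] [LieRingModule 𝔤 V]
    (μ : realCartan H) : Prop :=
  ∃ v : V, v ≠ 0 ∧
    (∀ h : H, ⁅(h : 𝔤), v⁆ = killingForm ℂ 𝔤 ((μ : H) : 𝔤) (h : 𝔤) • v) ∧
    ∀ α : H.root, b.IsPos α → ∀ e ∈ rootSpace H α.1, ⁅e, v⁆ = 0

/-- The sum of the Cartan subalgebra and of the root spaces of the positive roots. -/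
def borelSubmodule : LieSubmodule ℂ H 𝔤 :=
  H.toLieSubmodule ⊔ ⨆ α : {α : H.root // b.IsPos α}, rootSpace H α.1.1

lemma lie_mem_borelSubmodule {x y : 𝔤} (hx : x ∈ borelSubmodule b) (hy : y ∈ borelSubmodule b) :
    ⁅x, y⁆ ∈ borelSubmodule b := by
  have hH : ∀ h ∈ H, ∀ z ∈ borelSubmodule b, ⁅h, z⁆ ∈ borelSubmodule b := fun h hh z hz =>
    (borelSubmodule b).lie_mem (x := (⟨h, hh⟩ : H)) hz
  have hR : ∀ α : {α : H.root // b.IsPos α}, rootSpace H α.1.1 ≤ borelSubmodule b := fun α =>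
    (le_iSup (fun α : {α : H.root // b.IsPos α} => rootSpace H α.1.1) α).trans le_sup_right
  have hHle : H.toLieSubmodule ≤ borelSubmodule b := le_sup_left
  have hRR : ∀ α β : {α : H.root // b.IsPos α}, ∀ x ∈ rootSpace H α.1.1,
      ∀ y ∈ rootSpace H β.1.1, ⁅x, y⁆ ∈ borelSubmodule b := by
    intro α β x hx y hy
    have h1 : ⁅x, y⁆ ∈ rootSpace H (α.1.1 + β.1.1 : H → ℂ) :=
      lie_mem_genWeightSpace_of_mem_genWeightSpace hx hy
    by_cases h0 : rootSpace H (α.1.1 + β.1.1 : H → ℂ) = ⊥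
    · rw [h0, LieSubmodule.mem_bot] at h1
      rw [h1]
      exact zero_mem _
    · let γ : Weight ℂ H 𝔤 := ⟨_, h0⟩
      have hγ : γ.IsNonZero := by
        intro hz
        have hz' : (α.1.1 + β.1.1 : H → ℂ) = 0 := hz
        let := (rootSystem H).indexNeg
        have hneg : β.1 = -α.1 := by
          apply (rootSystem H).root.injective
          rw [RootPairing.indexNeg_neg, RootPairing.root_reflectionPerm,
            RootPairing.reflection_apply_self]
          ext h
          simpa using eq_neg_of_add_eq_zero_right (congrFun hz' h)
        exact (RootPairing.Base.IsPos.neg_iff_not b α.1).mp (hneg ▸ β.2) α.2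
      let γ' : H.root := ⟨γ, by simpa using hγ⟩
      have hpos : b.IsPos γ' := α.2.add β.2 (by ext h; simp [γ', γ])
      exact hR ⟨γ', hpos⟩ h1
  have hRl : ∀ α : {α : H.root // b.IsPos α}, ∀ x ∈ rootSpace H α.1.1,
      ∀ z ∈ borelSubmodule b, ⁅x, z⁆ ∈ borelSubmodule b := by
    intro α x hx z hz
    obtain ⟨h, hh, r, hr, rfl⟩ := (LieSubmodule.mem_sup _ _ _).mp hz
    rw [lie_add]
    refine add_mem ?_ ?_
    · rw [← lie_skew]
      exact neg_mem (hH h hh x (hR α hx))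
    · clear hz
      induction hr using LieSubmodule.iSup_induction' with
      | mem i y hy => exact hRR α i x hx y hy
      | zero => simp
      | add _ _ _ _ h1 h2 => rw [lie_add]; exact add_mem h1 h2
  have hRs : ∀ r ∈ ⨆ α : {α : H.root // b.IsPos α}, rootSpace H α.1.1,
      ⁅r, y⁆ ∈ borelSubmodule b := by
    intro r hr
    induction hr using LieSubmodule.iSup_induction' with
    | mem i x hx => exact hRl i x hx y hy
    | zero => simp
    | add _ _ _ _ h1 h2 => rw [add_lie]; exact add_mem h1 h2
  obtain ⟨h, hh, r, hr, rfl⟩ := (LieSubmodule.mem_sup _ _ _).mp hx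
  rw [add_lie]
  exact add_mem (hH h hh y hy) (hRs r hr)

/-- The Borel subalgebra `𝔟` defined by the positive roots. -/
def borel : LieSubalgebra ℂ 𝔤 :=
  { (borelSubmodule b).toSubmodule with
    lie_mem' := fun hx hy => lie_mem_borelSubmodule b hx hy }

/-- An ideal of `𝔟`, as a subspace of `𝔤`. -/
def idealSubspace (𝔞 : LieIdeal ℂ (borel b)) : Submodule ℂ 𝔤 :=
  𝔞.toSubmodule.map (borel b).toSubmodule.subtype

/-- The weight `λ_ξ` of an ideal `𝔞_ξ` of `𝔟`: the sum of the roots whose root space is contained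
in the ideal. -/
def idealWeight (𝔞 : LieIdeal ℂ (borel b)) : realCartan H :=
  open Classical in
  ∑ α : H.root with (rootSpace H α.1).toSubmodule ≤ idealSubspace b 𝔞, rootVec α

end

end Alcove

end

noncomputable section

namespace Alcove

set_option linter.unusedSectionVars false

open LieAlgebra LieAlgebra.IsKilling LieModule

variable {𝔤 : Type*} [LieRing 𝔤] [LieAlgebra ℂ 𝔤] [FiniteDimensional ℂ 𝔤] [IsSimple ℂ 𝔤]
variable {H : LieSubalgebra ℂ 𝔤} [H.IsCartanSubalgebra]

/-! ### The Killing form on the real Cartan subalgebra, roots and reflections -/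

section

/-! For a positive root φ put n_φ = ⌊(φ, σ(2ρ))⌋ (`wallCount`). The Killing form satisfies (ψ, ψ +
2ρ) = 1 (`killForm_highestRoot_two_rho`), so 2ρ is an interior point of the fundamental alcove.
Hence for dominant σ the number of walls (φ, x) = n between A₁ and A_σ is n_φ, and the usual
deletion argument for words in the Coxeter generators gives ℓ(σ) = Σ n_φ
(`length_eq_sum_wallCount`).

Every σ in the affine Weyl group satisfies (φ, σx) = (πφ, x) + m_φ for a permutation π of the roots
and integers m_φ, and on 𝔥 the Killing form is the sum of the squares of the roots. These two facts
yield λ^σ = Σ n_φ φ (`alcoveWeight_eq_sum`) and 2 Cas(λ^σ) = Σ n_φ(n_φ + 1)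
(`two_mul_cas_alcoveWeight`). Therefore 2(Cas(λ^σ) − ℓ(σ)) = Σ n_φ(n_φ − 1), whose terms are
nonnegative and all vanish exactly when every n_φ is 0 or 1, that is, when A_σ lies in (ψ, x) ≤ 2
(`mem_truncatedElements_two_iff`).

In that case the roots with n_φ = 1 are stable under adding positive roots, and no two of them add
up to a root γ, since n_γ would be at least 2. Their root spaces span an abelian ideal of weight λ^σ
and dimension ℓ(σ). Conversely every abelian ideal is spanned by the root spaces of an upward closed
set of positive roots, and such a set is determined by its sum (`subset_of_sum_rootVec_eq`).

The first assertion is independent of this: the Casimir element commutes with 𝔤, and its value on a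
highest weight vector is read off from root vectors. -/

lemma killForm_comm (x y : realCartan H) : killForm H x y = killForm H y x := by
  apply Complex.ofReal_injective
  rw [coe_killForm, coe_killForm, LieModule.traceForm_comm]

lemma apply_eq_killForm (φ : H.root) (x : realCartan H) :
    φ.1 (x : H) = (killForm H (rootVec φ) x : ℂ) := by
  rw [coe_killForm, killingForm_rootVec]

/-- The Killing form on `𝔥` is the sum of the squares of the roots. -/
lemma killForm_eq_sum (x y : realCartan H) :
    killForm H x y =
      ∑ φ : H.root, killForm H (rootVec φ) x * killForm H (rootVec φ) y := by
  apply Complex.ofReal_injective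
  rw [coe_killForm]
  have := congrArg (fun B => B (x : H) (y : H))
    (restrict_killingForm_eq_sum (K := ℂ) (L := 𝔤) (H := H))
  simp only [LinearMap.BilinForm.restrict_apply, LinearMap.sum_apply,
    LinearMap.smulRight_apply, LinearMap.smul_apply] at this
  rw [← Finset.sum_coe_sort] at this
  refine Eq.trans this ?_
  push_cast
  refine Finset.sum_congr rfl fun φ _ => ?_
  rw [← apply_eq_killForm, ← apply_eq_killForm]
  rfl

/-- The roots have no common zero on the Cartan subalgebra. Equality of vectors of 𝔥, and of affine
maps, is tested against roots in what follows. -/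
lemma eq_zero_of_forall_killForm_rootVec {x : realCartan H}
    (h : ∀ φ : H.root, killForm H (rootVec φ) x = 0) : x = 0 := by
  have h1 : (x : H) ∈ ⨅ α : Weight ℂ H 𝔤, α.ker := by
    refine (Submodule.mem_iInf _).mpr fun α => ?_
    by_cases hα : α.IsZero
    · exact congrFun hα _
    · have := apply_eq_killForm (⟨α, by simpa using hα⟩ : H.root) x
      rw [h] at this
      simpa using this
  rw [iInf_ker_weight_eq_bot] at h1
  exact Subtype.ext h1

lemma ext_killForm {x y : realCartan H}
    (h : ∀ φ : H.root, killForm H (rootVec φ) x = killForm H (rootVec φ) y) : x = y :=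
  sub_eq_zero.mp (eq_zero_of_forall_killForm_rootVec fun φ => by simp [h])

/-- A sum of squares of roots vanishes only where all roots do. -/
lemma killForm_self_pos {x : realCartan H} (hx : x ≠ 0) : 0 < killForm H x x := by
  rw [killForm_eq_sum]
  refine Finset.sum_pos' (fun _ _ => mul_self_nonneg _) ?_
  by_contra! h
  refine hx (eq_zero_of_forall_killForm_rootVec fun φ => ?_)
  have := h φ (Finset.mem_univ _)
  nlinarith [mul_self_nonneg (killForm H (rootVec φ) x)]

instance : InvolutiveNeg H.root := (rootSystem H).indexNeg

lemma coe_rootVec (φ : H.root) :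
    (rootVec φ : H) = (cartanEquivDual H).symm ((rootSystem H).root φ) := rfl

lemma root_neg (φ : H.root) : (rootSystem H).root (-φ) = -(rootSystem H).root φ := by
  change (rootSystem H).root ((rootSystem H).reflectionPerm φ φ) = _
  rw [RootPairing.root_reflectionPerm, RootPairing.reflection_apply_self]

lemma rootVec_injective : Function.Injective (rootVec (H := H)) := fun φ χ h => by
  have := congrArg (fun x : realCartan H => (x : H)) h
  exact (rootSystem H).root.injective ((cartanEquivDual H).symm.injective this)

lemma rootVec_neg (φ : H.root) : rootVec (-φ) = -rootVec φ :=
  Subtype.ext (by simp only [coe_rootVec, root_neg, map_neg, Submodule.coe_neg])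

lemma rootVec_ne_zero (φ : H.root) : rootVec φ ≠ 0 := fun h => by
  have := killForm_rootVec_self_pos φ
  simp [h] at this

lemma rootVec_eq_add_iff {i j k : H.root} : rootVec k = rootVec i + rootVec j ↔
    (rootSystem H).root k = (rootSystem H).root i + (rootSystem H).root j := by
  rw [← (cartanEquivDual H).symm.injective.eq_iff, map_add, ← coe_rootVec, ← coe_rootVec,
    ← coe_rootVec, ← Submodule.coe_add, Subtype.ext_iff]

lemma rootVec_eq_sub_iff {i j k : H.root} : rootVec k = rootVec i - rootVec j ↔
    (rootSystem H).root k = (rootSystem H).root i - (rootSystem H).root j := by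
  rw [← (cartanEquivDual H).symm.injective.eq_iff, map_sub, ← coe_rootVec, ← coe_rootVec,
    ← coe_rootVec, ← Submodule.coe_sub, Subtype.ext_iff]

lemma coe_corootVec (φ : H.root) : (corootVec φ : H) = (rootSystem H).coroot φ := by
  rw [rootSystem_coroot_apply, coroot_eq, apply_eq_killForm, corootVec, Submodule.coe_smul,
    ← Complex.coe_smul]
  push_cast
  rw [div_eq_mul_inv]

/-- The Cartan integer `(φ, α^∨)`. -/
def cartanInt (φ α : H.root) : ℤ := (rootSystem H).pairingIn ℤ φ α

lemma killForm_rootVec_corootVec_eq (φ α : H.root) :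
    killForm H (rootVec φ) (corootVec α) = cartanInt φ α := by
  apply Complex.ofReal_injective
  rw [← apply_eq_killForm, coe_corootVec, cartanInt, Complex.ofReal_intCast]
  exact ((rootSystem H).algebraMap_pairingIn ℤ φ α).symm

lemma two_mul_killForm_rootVec (φ α : H.root) : 2 * killForm H (rootVec φ) (rootVec α) =
    cartanInt φ α * killForm H (rootVec α) (rootVec α) := by
  have := (killForm_rootVec_self_pos α).ne'
  rw [← killForm_rootVec_corootVec_eq, corootVec, map_smul, smul_eq_mul]
  field_simp

lemma cartanInt_self (φ : H.root) : cartanInt φ φ = 2 := (rootSystem H).pairingIn_same ℤ φ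

lemma cartanInt_neg_left (φ α : H.root) : cartanInt (-φ) α = -cartanInt φ α := by
  exact_mod_cast show (cartanInt (-φ) α : ℝ) = -cartanInt φ α by
    rw [← killForm_rootVec_corootVec_eq, rootVec_neg, map_neg, LinearMap.neg_apply,
      killForm_rootVec_corootVec_eq]

lemma corootVec_neg (φ : H.root) : corootVec (-φ) = -corootVec φ := by
  rw [corootVec, rootVec_neg]
  simp [corootVec]

lemma rootReflection_apply (α : H.root) (x : realCartan H) :
    rootReflection α x = x - killForm H (rootVec α) x • corootVec α :=
  Module.reflection_apply _ _

lemma affineReflection_apply (α : H.root) (n : ℤ) (x : realCartan H) :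
    affineReflection α n x = x - (killForm H (rootVec α) x - n) • corootVec α := by
  have : affineReflection α n x = n • corootVec α + rootReflection α x := rfl
  rw [this, rootReflection_apply]
  module

lemma affineReflection_neg (α : H.root) (n : ℤ) :
    affineReflection (-α) (-n) = affineReflection α n := by
  refine AffineEquiv.ext fun x => ?_
  rw [affineReflection_apply, affineReflection_apply, rootVec_neg, corootVec_neg]
  simp only [map_neg, LinearMap.neg_apply, Int.cast_neg]
  module

lemma affineReflection_mul_self (α : H.root) (n : ℤ) :
    affineReflection α n * affineReflection α n = 1 := by
  refine AffineEquiv.ext fun x => ?_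
  rw [AffineEquiv.coe_mul, Function.comp_apply, affineReflection_apply,
    affineReflection_apply, AffineEquiv.coe_one, id]
  simp only [map_sub, map_smul, killForm_rootVec_corootVec, smul_eq_mul]
  module

lemma rootReflection_toAffineEquiv (α : H.root) :
    (rootReflection α).toAffineEquiv = affineReflection α 0 := by
  refine AffineEquiv.ext fun x => ?_
  simp [affineReflection_apply, rootReflection_apply]

/-- The permutation of the roots defined by a reflection. -/
abbrev reflPerm (α : H.root) : Equiv.Perm H.root := (rootSystem H).reflectionPerm α

lemma rootVec_reflPerm (α φ : H.root) :
    rootVec (reflPerm α φ) = rootVec φ - (cartanInt φ α : ℝ) • rootVec α := by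
  apply Subtype.ext
  rw [coe_rootVec, RootPairing.root_reflectionPerm, RootPairing.reflection_apply_root' ℤ, map_sub,
    map_zsmul, Submodule.coe_sub, Submodule.coe_smul, ← Complex.coe_smul, Complex.ofReal_intCast,
    Int.cast_smul_eq_zsmul]
  rfl

lemma killForm_rootVec_reflPerm (α φ : H.root) (x : realCartan H) :
    killForm H (rootVec (reflPerm α φ)) x = killForm H (rootVec φ) (rootReflection α x) := by
  rw [rootVec_reflPerm, rootReflection_apply, map_sub, map_smul, map_sub, map_smul,
    killForm_rootVec_corootVec_eq]
  simp [mul_comm]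

/-- A reflection permutes the roots, hence only reorders the sum of products of roots that defines
the form. -/
lemma killForm_rootReflection (α : H.root) (x y : realCartan H) :
    killForm H (rootReflection α x) (rootReflection α y) = killForm H x y := by
  rw [killForm_eq_sum, killForm_eq_sum x y]
  refine Fintype.sum_equiv (reflPerm α) _ _ fun φ => ?_
  rw [killForm_rootVec_reflPerm, killForm_rootVec_reflPerm]

lemma rootVec_reflPerm_eq (α φ : H.root) :
    rootVec (reflPerm α φ) = rootReflection α (rootVec φ) := by
  rw [rootVec_reflPerm, rootReflection_apply, killForm_comm, corootVec, smul_smul]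
  congr 2
  have := (killForm_rootVec_self_pos α).ne'
  have := two_mul_killForm_rootVec φ α
  field_simp
  linarith

lemma reflPerm_self (α : H.root) : reflPerm α α = -α := rfl

lemma cartanInt_pos_iff {φ α : H.root} :
    0 < cartanInt φ α ↔ 0 < killForm H (rootVec φ) (rootVec α) := by
  have h := two_mul_killForm_rootVec φ α
  have h1 := killForm_rootVec_self_pos α
  rw [← Int.cast_pos (R := ℝ)]
  constructor
  · intro h2
    have := mul_pos h2 h1
    linarith
  · intro h2
    by_contra! h3
    nlinarith

lemma exists_root_sub {φ α : H.root} (h : 0 < killForm H (rootVec φ) (rootVec α)) (hne : φ ≠ α) :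
    ∃ γ : H.root, rootVec γ = rootVec φ - rootVec α := by
  obtain ⟨γ, hγ⟩ := (rootSystem H).root_sub_root_mem_of_pairingIn_pos (cartanInt_pos_iff.mpr h) hne
  exact ⟨γ, rootVec_eq_sub_iff.mpr hγ⟩

section Base

variable (b : (rootSystem H).Base)

lemma isPos_neg_iff (φ : H.root) : b.IsPos (-φ) ↔ ¬ b.IsPos φ :=
  RootPairing.Base.IsPos.neg_iff_not b φ

lemma isPos_or_isPos_neg (φ : H.root) : b.IsPos φ ∨ b.IsPos (-φ) :=
  RootPairing.Base.IsPos.or_neg b φ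

lemma height_neg (φ : H.root) : b.height (-φ) = -b.height φ :=
  b.height_reflectionPerm_self φ

lemma height_le_highestRoot (φ : H.root) : b.height φ ≤ b.height (highestRoot b) :=
  Classical.choose_spec (haveI := nonempty_root (H := H); Finite.exists_max b.height) φ

variable {b}

/-- A positive root is a sum of simple roots. -/
lemma exists_rootVec_eq_sum {φ : H.root} (hφ : b.IsPos φ) :
    ∃ c : H.root → ℕ, rootVec φ = ∑ α ∈ b.support, c α • rootVec α := by
  obtain ⟨c, hc⟩ : ∃ c : H.root → ℕ, (rootSystem H).root φ =
      ∑ α ∈ b.support, c α • (rootSystem H).root α := by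
    obtain ⟨c, -, hc | hc⟩ := b.exists_root_eq_sum_nat_or_neg φ
    · exact ⟨c, hc⟩
    · exfalso
      have : b.height φ = ∑ α ∈ b.support, (-(c α : ℤ)) := by
        refine RootPairing.Base.height_eq_sum (f := fun α => -(c α : ℤ)) ?_
        simp [hc]
      have h2 : b.height φ ≤ 0 := this ▸ Finset.sum_nonpos fun _ _ => by simp
      exact absurd hφ (not_lt.mpr h2)
  refine ⟨c, Subtype.ext ?_⟩
  rw [coe_rootVec, hc, map_sum, Submodule.coe_sum]
  refine Finset.sum_congr rfl fun α _ => ?_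
  rw [map_nsmul, Submodule.coe_smul_of_tower, coe_rootVec]

lemma killForm_nonneg_of_isPos {φ : H.root} (hφ : b.IsPos φ) {x : realCartan H}
    (hx : ∀ α ∈ b.support, 0 ≤ killForm H (rootVec α) x) : 0 ≤ killForm H (rootVec φ) x := by
  obtain ⟨c, hc⟩ := exists_rootVec_eq_sum hφ
  rw [hc, map_sum, LinearMap.sum_apply]
  refine Finset.sum_nonneg fun α hα => ?_
  rw [map_nsmul, LinearMap.smul_apply, nsmul_eq_mul]
  exact mul_nonneg (Nat.cast_nonneg _) (hx α hα)

lemma killForm_pos_of_isPos {φ : H.root} (hφ : b.IsPos φ) {x : realCartan H}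
    (hx : ∀ α ∈ b.support, 0 < killForm H (rootVec α) x) : 0 < killForm H (rootVec φ) x := by
  refine (killForm_nonneg_of_isPos hφ fun α hα => (hx α hα).le).lt_of_ne' fun h0 => ?_
  obtain ⟨c, hc⟩ := exists_rootVec_eq_sum hφ
  rw [hc, map_sum, LinearMap.sum_apply, Finset.sum_eq_zero_iff_of_nonneg] at h0
  · refine rootVec_ne_zero φ (hc.trans (Finset.sum_eq_zero fun α hα => ?_))
    have := h0 α hα
    rw [map_nsmul, LinearMap.smul_apply, nsmul_eq_mul, mul_eq_zero,
      or_iff_left (hx α hα).ne'] at this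
    rw [Nat.cast_eq_zero.mp this, zero_smul]
  · intro α hα
    rw [map_nsmul, LinearMap.smul_apply, nsmul_eq_mul]
    exact mul_nonneg (Nat.cast_nonneg _) (hx α hα).le

end Base

end

/-! ### The highest root, and 2ρ as an interior point of the fundamental alcove -/

section

variable (b : (rootSystem H).Base)

open Classical in
/-- The set of positive roots. -/
def posRoots : Finset H.root := Finset.univ.filter b.IsPos

variable {b}

@[simp]
lemma mem_posRoots {φ : H.root} : φ ∈ posRoots b ↔ b.IsPos φ := by simp [posRoots]

lemma sum_eq_sum_posRoots (f : H.root → ℝ) :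
    ∑ φ, f φ = ∑ φ ∈ posRoots b, (f φ + f (-φ)) := by
  classical
  rw [Finset.sum_add_distrib, ← Finset.sum_filter_add_sum_filter_not Finset.univ b.IsPos]
  congr 1
  refine Finset.sum_equiv (Equiv.neg _) (fun φ => ?_) fun φ _ => congrArg f (neg_neg φ).symm
  rw [Finset.mem_filter, mem_posRoots, Equiv.neg_apply, isPos_neg_iff]
  simp

lemma isPos_highestRoot : b.IsPos (highestRoot b) := by
  have := nonempty_root (H := H)
  obtain ⟨α, hα⟩ := b.support_nonempty
  have := height_le_highestRoot b α
  rw [b.height_one_of_mem_support hα] at this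
  rw [RootPairing.Base.isPos_iff]
  lia

lemma isPos_of_mem_support {α : H.root} (hα : α ∈ b.support) : b.IsPos α :=
  RootPairing.Base.isPos_of_mem_support hα

lemma height_eq_add {i j k : H.root} (h : rootVec k = rootVec i + rootVec j) :
    b.height k = b.height i + b.height j :=
  b.height_add (rootVec_eq_add_iff.mp h)

lemma ne_neg_of_isPos {φ χ : H.root} (hφ : b.IsPos φ) (hχ : b.IsPos χ) : φ ≠ -χ := fun h => by
  rw [h, isPos_neg_iff] at hφ
  exact hφ hχ

lemma killForm_simple_nonpos {α β : H.root} (hα : α ∈ b.support) (hβ : β ∈ b.support)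
    (hne : α ≠ β) : killForm H (rootVec α) (rootVec β) ≤ 0 := by
  by_contra! h
  exact absurd (cartanInt_pos_iff.mpr h) (not_lt.mpr (b.pairingIn_le_zero_of_ne hne hα hβ))

/-- If `φ` and `α` are roots with `(φ,α) < 0` and `φ ≠ -α`, then `φ + α` is a root. -/
lemma exists_root_add {φ α : H.root} (h : killForm H (rootVec φ) (rootVec α) < 0) (hne : φ ≠ -α) :
    ∃ γ : H.root, rootVec γ = rootVec φ + rootVec α := by
  obtain ⟨γ, hγ⟩ := exists_root_sub (φ := φ) (α := -α) (by rw [rootVec_neg]; simpa using h) hne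
  exact ⟨γ, by rw [hγ, rootVec_neg, sub_neg_eq_add]⟩

/-- Otherwise ψ + φ would be a root of greater height. -/
lemma killForm_highestRoot_nonneg {φ : H.root} (hφ : b.IsPos φ) :
    0 ≤ killForm H (rootVec (highestRoot b)) (rootVec φ) := by
  by_contra! h
  obtain ⟨γ, hγ⟩ := exists_root_add h (ne_neg_of_isPos isPos_highestRoot hφ)
  have h1 := height_eq_add (b := b) hγ
  have h2 := height_le_highestRoot b γ
  rw [RootPairing.Base.isPos_iff] at hφ
  lia

/-- Only the maximality of the height of ψ is used. If c = (φ, ψ^∨) ≥ 2, then the root −s_ψ φ = cψ −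
φ has height at most that of ψ, which forces φ and ψ to have equal height; but then φ − ψ is a root
of height 0. -/
lemma cartanInt_highestRoot {φ : H.root} (hφ : b.IsPos φ) (hne : φ ≠ highestRoot b) :
    cartanInt φ (highestRoot b) = 0 ∨ cartanInt φ (highestRoot b) = 1 := by
  have h0 : 0 ≤ cartanInt φ (highestRoot b) := by
    by_contra! h
    have h1 := two_mul_killForm_rootVec φ (highestRoot b)
    have h2 := killForm_rootVec_self_pos (highestRoot b)
    have h3 := killForm_highestRoot_nonneg hφ
    rw [killForm_comm] at h3
    have h4 : (cartanInt φ (highestRoot b) : ℝ) < 0 := by exact_mod_cast h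
    nlinarith
  by_contra! hcon
  have hc : 2 ≤ cartanInt φ (highestRoot b) := by lia
  have h1 : b.height (reflPerm (highestRoot b) φ) =
      b.height φ + (-cartanInt φ (highestRoot b)) • b.height (highestRoot b) := by
    refine b.height_add_zsmul ?_
    rw [RootPairing.root_reflectionPerm, RootPairing.reflection_apply_root' ℤ, neg_smul,
      sub_eq_add_neg]
    rfl
  have h2 := height_le_highestRoot b (-reflPerm (highestRoot b) φ)
  rw [height_neg, h1, smul_eq_mul] at h2
  have h3 := height_le_highestRoot b φ
  have h4 := isPos_highestRoot (b := b)
  rw [RootPairing.Base.isPos_iff] at h4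
  have h5 : b.height φ = b.height (highestRoot b) := by nlinarith
  obtain ⟨γ, hγ⟩ := exists_root_sub (cartanInt_pos_iff.mp (by lia)) hne
  have h6 : b.height φ = b.height γ + b.height (highestRoot b) :=
    height_eq_add (by rw [hγ, sub_add_cancel])
  exact b.height_ne_zero γ (by lia)

/-- Irreducibility enters here: a dominant root involves every simple root, since a missing simple
root adjacent to a present one would have negative product with θ. So (ψ, θ) is a positive
combination of the numbers (ψ, α) ≥ 0, and these are not all zero. -/
lemma killForm_highestRoot_pos_of_dominant {θ : H.root}
    (hθ : ∀ α ∈ b.support, 0 ≤ killForm H (rootVec θ) (rootVec α)) :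
    0 < killForm H (rootVec (highestRoot b)) (rootVec θ) := by
  have hpos : b.IsPos θ := by
    by_contra h
    rw [← isPos_neg_iff] at h
    have h1 := killForm_nonneg_of_isPos h (x := rootVec θ) fun α hα => by
      rw [killForm_comm]; exact hθ α hα
    rw [rootVec_neg, map_neg, LinearMap.neg_apply] at h1
    linarith [killForm_rootVec_self_pos θ]
  obtain ⟨c, hc⟩ := exists_rootVec_eq_sum hpos
  have hsum (x : realCartan H) : killForm H (rootVec θ) x =
      ∑ α ∈ b.support, (c α : ℝ) * killForm H (rootVec α) x := by
    rw [hc, map_sum, LinearMap.sum_apply]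
    exact Finset.sum_congr rfl fun α _ => by rw [map_nsmul, LinearMap.smul_apply, nsmul_eq_mul]
  have hfull : ∀ j : b.support, 0 < c j := by
    obtain ⟨i, hi, hi0⟩ : ∃ i ∈ b.support, 0 < c i := by
      by_contra! h
      exact rootVec_ne_zero θ (hc.trans (Finset.sum_eq_zero fun α hα => by
        rw [Nat.le_zero.mp (h α hα), zero_smul]))
    intro j
    refine b.induction_on_cartanMatrix (fun j => 0 < c j) (i := ⟨i, hi⟩) hi0 fun i j hi hij => ?_
    by_contra! h0
    have hcj : c j = 0 := Nat.le_zero.mp h0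
    have hne : (i : H.root) ≠ j := fun h => by rw [h, hcj] at hi; exact lt_irrefl _ hi
    have h1 : cartanInt (j : H.root) i ≠ 0 := hij
    have h2 : killForm H (rootVec (i : H.root)) (rootVec (j : H.root)) ≠ 0 := fun h => by
      have h3 := two_mul_killForm_rootVec (j : H.root) i
      rw [killForm_comm, h, mul_zero, zero_eq_mul, Int.cast_eq_zero] at h3
      exact h3.elim h1 (killForm_rootVec_self_pos _).ne'
    have h3 := hθ j j.2
    rw [hsum] at h3
    refine absurd h3 (not_le.mpr (Finset.sum_neg' (fun k hk => ?_) ⟨i, i.2, ?_⟩))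
    · by_cases hkj : k = j
      · rw [hkj, hcj, Nat.cast_zero, zero_mul]
      · exact mul_nonpos_of_nonneg_of_nonpos (Nat.cast_nonneg _)
          (killForm_simple_nonpos hk j.2 hkj)
    · exact mul_neg_of_pos_of_neg (Nat.cast_pos.mpr hi)
        ((killForm_simple_nonpos i.2 j.2 hne).lt_of_ne h2)
  rw [killForm_comm, hsum]
  have hnn (α) (hα : α ∈ b.support) :
      0 ≤ killForm H (rootVec α) (rootVec (highestRoot b)) := by
    rw [killForm_comm]
    exact killForm_highestRoot_nonneg (isPos_of_mem_support hα)
  refine Finset.sum_pos' (fun α hα => mul_nonneg (Nat.cast_nonneg _) (hnn α hα)) ?_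
  by_contra! h
  have h0 : ∀ α ∈ b.support, killForm H (rootVec α) (rootVec (highestRoot b)) = 0 :=
    fun α hα => by
      have h1 : (0 : ℝ) < c α := Nat.cast_pos.mpr (hfull ⟨α, hα⟩)
      have h2 := h α hα
      have h3 := hnn α hα
      nlinarith
  have h1 := killForm_nonneg_of_isPos isPos_highestRoot (b := b)
    (x := -rootVec (highestRoot b)) fun α hα => by simp [h0 α hα]
  rw [map_neg] at h1
  linarith [killForm_rootVec_self_pos (highestRoot b)]

/-- The highest root is dominant over all roots on the closed Weyl chamber. -/
lemma killForm_le_highestRoot {x : realCartan H}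
    (hx : ∀ α ∈ b.support, 0 ≤ killForm H (rootVec α) x) (φ : H.root) :
    killForm H (rootVec φ) x ≤ killForm H (rootVec (highestRoot b)) x := by
  classical
  -- Among the roots whose value at x is at least that of φ, take one of greatest height. It is
  -- dominant, because adding a simple root would raise the height without lowering the value.
  obtain ⟨θ, hθ, hmax⟩ := Finset.exists_max_image
    (Finset.univ.filter fun θ : H.root => killForm H (rootVec φ) x ≤ killForm H (rootVec θ) x)
    b.height ⟨φ, by simp⟩
  simp only [Finset.mem_filter, Finset.mem_univ, true_and] at hθ hmax
  have hdom : ∀ α ∈ b.support, 0 ≤ killForm H (rootVec θ) (rootVec α) := by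
    intro α hα
    by_contra! h
    have hαpos := isPos_of_mem_support hα
    have hα1 := b.height_one_of_mem_support hα
    by_cases hne : θ = -α
    · have h1 := hmax α (hθ.trans (by
        rw [hne, rootVec_neg, map_neg, LinearMap.neg_apply]; linarith [hx α hα]))
      rw [hne, height_neg] at h1
      lia
    · obtain ⟨γ, hγ⟩ := exists_root_add h hne
      have h1 := hmax γ (hθ.trans (by rw [hγ, map_add, LinearMap.add_apply]; linarith [hx α hα]))
      have h2 := height_eq_add (b := b) hγ
      lia
  have hpos := killForm_highestRoot_pos_of_dominant hdom
  by_cases hne : highestRoot b = θ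
  · rwa [hne]
  obtain ⟨γ, hγ⟩ := exists_root_sub hpos hne
  have hγpos : b.IsPos γ := by
    rw [RootPairing.Base.isPos_iff']
    have h1 : b.height (highestRoot b) = b.height γ + b.height θ :=
      height_eq_add (by rw [hγ, sub_add_cancel])
    have h2 := height_le_highestRoot b θ
    lia
  have h1 := killForm_nonneg_of_isPos hγpos hx
  rw [hγ, map_sub, LinearMap.sub_apply] at h1
  linarith

lemma two_smul_rho : (2 : ℝ) • rho b = ∑ φ ∈ posRoots b, rootVec φ := by
  rw [rho, smul_smul, mul_one_div_cancel two_ne_zero, one_smul, posRoots]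

lemma isPos_reflPerm {α φ : H.root} (hα : α ∈ b.support) (hφ : b.IsPos φ) (hne : φ ≠ α) :
    b.IsPos (reflPerm α φ) :=
  RootPairing.Base.IsPos.reflectionPerm hφ hα hne

lemma reflPerm_reflPerm (α φ : H.root) : reflPerm α (reflPerm α φ) = φ :=
  (rootSystem H).reflectionPerm_self α φ

lemma reflPerm_neg (α φ : H.root) : reflPerm α (-φ) = -reflPerm α φ :=
  rootVec_injective (by rw [rootVec_reflPerm_eq, rootVec_neg, rootVec_neg, rootVec_reflPerm_eq,
    map_neg])

/-- The reflection s_α permutes the positive roots other than α, so their sum is orthogonal to α. -/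
lemma killForm_simple_two_rho {α : H.root} (hα : α ∈ b.support) :
    killForm H (rootVec α) ((2 : ℝ) • rho b) = killForm H (rootVec α) (rootVec α) := by
  classical
  have hαpos := isPos_of_mem_support hα
  have hstep : ∀ φ, φ ∈ (posRoots b).erase α → reflPerm α φ ∈ (posRoots b).erase α := by
    intro φ hφ
    rw [Finset.mem_erase, mem_posRoots] at hφ ⊢
    refine ⟨fun h => ?_, isPos_reflPerm hα hφ.2 hφ.1⟩
    have : φ = -α := (reflPerm_reflPerm α φ).symm.trans (by rw [h, reflPerm_self])
    exact ne_neg_of_isPos hφ.2 hαpos this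
  have hfix : rootReflection α (∑ φ ∈ (posRoots b).erase α, rootVec φ) =
      ∑ φ ∈ (posRoots b).erase α, rootVec φ := by
    rw [map_sum]
    refine Finset.sum_equiv (reflPerm α)
      (fun φ => ⟨hstep φ, fun h => reflPerm_reflPerm α φ ▸ hstep _ h⟩)
      fun φ _ => (rootVec_reflPerm_eq α φ).symm
  have h0 : killForm H (rootVec α) (∑ φ ∈ (posRoots b).erase α, rootVec φ) = 0 := by
    have h1 := killForm_rootVec_reflPerm α α (∑ φ ∈ (posRoots b).erase α, rootVec φ)
    rw [hfix, reflPerm_self, rootVec_neg, map_neg, LinearMap.neg_apply] at h1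
    linarith
  rw [two_smul_rho, ← Finset.add_sum_erase _ _ (mem_posRoots.mpr hαpos), map_add, h0, add_zero]

lemma killForm_two_rho_pos {φ : H.root} (hφ : b.IsPos φ) :
    0 < killForm H (rootVec φ) ((2 : ℝ) • rho b) :=
  killForm_pos_of_isPos hφ fun α hα => by
    rw [killForm_simple_two_rho hα]
    exact killForm_rootVec_self_pos α

/-- The Killing form is normalized by `(ψ,ψ+2ρ) = 1`. -/
lemma killForm_highestRoot_two_rho : killForm H (rootVec (highestRoot b)) ((2 : ℝ) • rho b) =
    1 - killForm H (rootVec (highestRoot b)) (rootVec (highestRoot b)) := by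
  classical
  set ψ := highestRoot b
  set q := killForm H (rootVec ψ) (rootVec ψ) with hq
  have hq0 : 0 < q := killForm_rootVec_self_pos ψ
  have h1 : q = ∑ φ ∈ posRoots b, 2 * killForm H (rootVec φ) (rootVec ψ) ^ 2 := by
    rw [hq, killForm_eq_sum, sum_eq_sum_posRoots (b := b)]
    refine Finset.sum_congr rfl fun φ _ => ?_
    rw [rootVec_neg, map_neg, LinearMap.neg_apply]
    ring
  have hψ : ψ ∈ posRoots b := mem_posRoots.mpr isPos_highestRoot
  -- For positive φ ≠ ψ the product (φ, ψ) is 0 or q/2, so the quadratic sum for q = (ψ, ψ) becomes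
  -- q times a linear one; dividing by q leaves the claim.
  have h2 : ∀ φ ∈ (posRoots b).erase ψ, 2 * killForm H (rootVec φ) (rootVec ψ) ^ 2 =
      q * killForm H (rootVec φ) (rootVec ψ) := by
    intro φ hφ
    rw [Finset.mem_erase, mem_posRoots] at hφ
    have h3 := two_mul_killForm_rootVec φ ψ
    rw [← hq] at h3
    rcases cartanInt_highestRoot hφ.2 hφ.1 with h | h <;> rw [h] at h3
    · rw [Int.cast_zero, zero_mul] at h3
      have : killForm H (rootVec φ) (rootVec ψ) = 0 := by linarith
      simp [this]
    · rw [Int.cast_one, one_mul] at h3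
      rw [← h3]
      ring
  rw [← Finset.add_sum_erase _ _ hψ, Finset.sum_congr rfl h2, ← Finset.mul_sum, ← hq] at h1
  rw [two_smul_rho, ← Finset.add_sum_erase _ _ hψ, map_add, ← hq, map_sum]
  simp_rw [killForm_comm (rootVec ψ)]
  have h3 : q * (1 - 2 * q - ∑ φ ∈ (posRoots b).erase ψ, killForm H (rootVec φ) (rootVec ψ)) = 0 := by
    linarith
  have h4 := (mul_eq_zero.mp h3).resolve_left hq0.ne'
  linarith

/-- With `killForm_two_rho_pos`, this puts 2ρ in the interior of A₁, so that 2ρ and σ(2ρ) can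
represent the alcoves A₁ and A_σ when walls are counted. -/
lemma killForm_two_rho_lt_one (φ : H.root) : killForm H (rootVec φ) ((2 : ℝ) • rho b) < 1 := by
  refine (killForm_le_highestRoot (b := b) (fun α hα => ?_) φ).trans_lt ?_
  · exact (killForm_two_rho_pos (isPos_of_mem_support hα)).le
  · rw [killForm_highestRoot_two_rho]
    linarith [killForm_rootVec_self_pos (highestRoot b)]

lemma killForm_two_rho_ne_intCast (φ : H.root) (n : ℤ) :
    killForm H (rootVec φ) ((2 : ℝ) • rho b) ≠ n := by
  intro h
  have key : ∀ φ : H.root, b.IsPos φ → ∀ n : ℤ, killForm H (rootVec φ) ((2 : ℝ) • rho b) ≠ n := by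
    intro φ hφ n h
    have h1 := killForm_two_rho_pos hφ
    have h2 := killForm_two_rho_lt_one (b := b) φ
    rw [h] at h1 h2
    have h3 : 0 < n := by exact_mod_cast h1
    have h4 : n < 1 := by exact_mod_cast h2
    lia
  rcases isPos_or_isPos_neg b φ with hφ | hφ
  · exact key φ hφ n h
  · refine key _ hφ (-n) ?_
    rw [rootVec_neg, map_neg, LinearMap.neg_apply, h, Int.cast_neg]

end

/-! ### The action of the affine Weyl group on affine forms -/

section

/-- The affine transformation `σ` of `𝔥` permutes the affine forms `(φ,·) + n`: it satisfies
`(φ, σ x) = (π φ, x) + m φ`, and its linear part is an isometry. -/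
def PermutesAffineForms (σ : realCartan H ≃ᵃ[ℝ] realCartan H) (π : Equiv.Perm H.root)
    (m : H.root → ℤ) : Prop :=
  (∀ φ x, killForm H (rootVec φ) (σ x) = killForm H (rootVec (π φ)) x + m φ) ∧
    ∀ φ χ, killForm H (rootVec (π φ)) (rootVec (π χ)) = killForm H (rootVec φ) (rootVec χ)

namespace PermutesAffineForms

variable {σ τ : realCartan H ≃ᵃ[ℝ] realCartan H} {π π' : Equiv.Perm H.root} {m m' : H.root → ℤ}

lemma one : PermutesAffineForms (1 : realCartan H ≃ᵃ[ℝ] realCartan H) 1 0 := by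
  constructor <;> simp

/-- Forms are pulled back, so the permutations compose in the reverse order. -/
lemma mul (h : PermutesAffineForms σ π m) (h' : PermutesAffineForms τ π' m') :
    PermutesAffineForms (σ * τ) (π' * π) (fun φ => m' (π φ) + m φ) := by
  constructor
  · intro φ x
    rw [AffineEquiv.coe_mul, Function.comp_apply, h.1, h'.1, Equiv.Perm.mul_apply]
    push_cast
    ring
  · intro φ χ
    rw [Equiv.Perm.mul_apply, Equiv.Perm.mul_apply, h'.2, h.2]

lemma inv (h : PermutesAffineForms σ π m) :
    PermutesAffineForms σ⁻¹ π⁻¹ (fun φ => -m (π⁻¹ φ)) := by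
  constructor
  · intro φ x
    have h1 := h.1 (π⁻¹ φ) (σ⁻¹ x)
    have h2 : σ (σ⁻¹ x) = x := σ.apply_symm_apply x
    rw [h2, show π (π⁻¹ φ) = φ from π.apply_symm_apply φ] at h1
    rw [h1]
    push_cast
    ring
  · intro φ χ
    rw [← h.2, show π (π⁻¹ φ) = φ from π.apply_symm_apply φ,
      show π (π⁻¹ χ) = χ from π.apply_symm_apply χ]

lemma killForm_corootVec (h : PermutesAffineForms σ π m) (φ χ : H.root) :
    killForm H (rootVec (π χ)) (corootVec (π φ)) = killForm H (rootVec χ) (corootVec φ) := by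
  rw [corootVec, corootVec, map_smul, map_smul, h.2, h.2]

lemma mul_affineReflection (h : PermutesAffineForms σ π m) (φ : H.root) (k : ℤ) :
    σ * affineReflection (π φ) k = affineReflection φ (k + m φ) * σ := by
  refine AffineEquiv.ext fun x => ext_killForm fun χ => ?_
  rw [AffineEquiv.coe_mul, AffineEquiv.coe_mul, Function.comp_apply, Function.comp_apply, h.1,
    affineReflection_apply, affineReflection_apply, map_sub, map_sub, map_smul, map_smul,
    h.killForm_corootVec, h.1, h.1]
  push_cast
  simp only [smul_eq_mul]
  ring

lemma conj_affineReflection (h : PermutesAffineForms σ π m) (φ : H.root) (k : ℤ) :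
    σ * affineReflection (π φ) k * σ⁻¹ = affineReflection φ (k + m φ) := by
  rw [h.mul_affineReflection, mul_inv_cancel_right]

/-- As π preserves inner products, π(−φ) + π(φ) has the same norm as −φ + φ, namely 0. -/
lemma map_neg_perm (h : PermutesAffineForms σ π m) (φ : H.root) : π (-φ) = -π φ := by
  have key : killForm H (rootVec (π (-φ)) + rootVec (π φ))
      (rootVec (π (-φ)) + rootVec (π φ)) = 0 := by
    simp only [map_add, LinearMap.add_apply, h.2, rootVec_neg, map_neg, LinearMap.neg_apply]
    ring
  apply rootVec_injective
  rw [rootVec_neg]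
  by_contra hne
  exact (killForm_self_pos fun h0 => hne (eq_neg_of_add_eq_zero_left h0)).ne' key

lemma map_neg_int (h : PermutesAffineForms σ π m) (φ : H.root) : m (-φ) = -m φ := by
  have h1 := h.1 (-φ) 0
  have h2 := h.1 φ 0
  rw [rootVec_neg, map_neg, LinearMap.neg_apply, h2] at h1
  simp only [map_zero, zero_add] at h1
  exact_mod_cast h1.symm

lemma killForm_map_zero (h : PermutesAffineForms σ π m) (φ : H.root) :
    killForm H (rootVec φ) (σ 0) = m φ := by
  simpa using h.1 φ 0

end PermutesAffineForms

lemma killForm_rootVec_affineReflection (φ α : H.root) (n : ℤ) (x : realCartan H) :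
    killForm H (rootVec φ) (affineReflection α n x) =
      killForm H (rootVec φ) x - (killForm H (rootVec α) x - n) * cartanInt φ α := by
  rw [affineReflection_apply, map_sub, map_smul, killForm_rootVec_corootVec_eq, smul_eq_mul]

lemma permutesAffineForms_affineReflection (α : H.root) (n : ℤ) :
    PermutesAffineForms (affineReflection α n) (reflPerm α) (fun φ => n * cartanInt φ α) := by
  constructor
  · intro φ x
    rw [killForm_rootVec_affineReflection, killForm_rootVec_reflPerm, rootReflection_apply,
      map_sub, map_smul, killForm_rootVec_corootVec_eq]
    push_cast
    simp only [smul_eq_mul]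
    ring
  · intro φ χ
    rw [rootVec_reflPerm_eq, rootVec_reflPerm_eq, killForm_rootReflection]

lemma exists_killForm_rootVec_eq_intCast {v : realCartan H} (hv : v ∈ corootLattice H)
    (φ : H.root) : ∃ n : ℤ, killForm H (rootVec φ) v = n := by
  induction hv using AddSubgroup.closure_induction with
  | mem x hx =>
    obtain ⟨α, rfl⟩ := hx
    exact ⟨_, killForm_rootVec_corootVec_eq φ α⟩
  | zero => exact ⟨0, by simp⟩
  | add x y _ _ hx hy =>
    obtain ⟨k, hk⟩ := hx
    obtain ⟨l, hl⟩ := hy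
    exact ⟨k + l, by rw [map_add, hk, hl, Int.cast_add]⟩
  | neg x _ hx =>
    obtain ⟨k, hk⟩ := hx
    exact ⟨-k, by rw [map_neg, hk, Int.cast_neg]⟩

/-- The transformations with this property form a group containing the translations by Γ, on which
roots are integral, and the reflections. -/
lemma exists_permutesAffineForms {σ : realCartan H ≃ᵃ[ℝ] realCartan H}
    (hσ : σ ∈ affineWeylGroup H) : ∃ π m, PermutesAffineForms σ π m := by
  let S : Subgroup (realCartan H ≃ᵃ[ℝ] realCartan H) :=
    { carrier := {σ | ∃ π m, PermutesAffineForms σ π m}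
      mul_mem' := fun ⟨_, _, h⟩ ⟨_, _, h'⟩ => ⟨_, _, h.mul h'⟩
      one_mem' := ⟨_, _, .one⟩
      inv_mem' := fun ⟨_, _, h⟩ => ⟨_, _, h.inv⟩ }
  suffices affineWeylGroup H ≤ S from this hσ
  refine sup_le ?_ ((Subgroup.closure_le _).mpr ?_)
  · rintro _ ⟨v, hv, rfl⟩
    choose m hm using exists_killForm_rootVec_eq_intCast (v := v.toAdd) hv
    refine ⟨1, m, fun φ x => ?_, fun φ χ => rfl⟩
    have : AffineEquiv.constVAddHom ℝ (realCartan H) v x = v.toAdd + x := rfl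
    rw [this, map_add, hm, add_comm]
    rfl
  · rintro _ ⟨α, rfl⟩
    change (rootReflection α).toAffineEquiv ∈ S
    rw [rootReflection_toAffineEquiv]
    exact ⟨_, _, permutesAffineForms_affineReflection α 0⟩

lemma corootVec_reflPerm (α β : H.root) :
    corootVec (reflPerm α β) = rootReflection α (corootVec β) := by
  rw [corootVec, corootVec, rootVec_reflPerm_eq, killForm_rootReflection, map_smul]

lemma cartanInt_reflPerm_right (α φ β : H.root) :
    cartanInt φ (reflPerm α β) = cartanInt (reflPerm α φ) β := by
  exact_mod_cast show (cartanInt φ (reflPerm α β) : ℝ) = cartanInt (reflPerm α φ) β by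
    rw [← killForm_rootVec_corootVec_eq, ← killForm_rootVec_corootVec_eq, corootVec_reflPerm,
      killForm_rootVec_reflPerm]

/-! ### Generation of the affine Weyl group by the Coxeter generators -/

section Generation

variable (b : (rootSystem H).Base)

/-- The group generated by the Coxeter generators. -/
abbrev coxeterGroup : Subgroup (realCartan H ≃ᵃ[ℝ] realCartan H) :=
  Subgroup.closure (coxeterGenerators b)

lemma affineReflection_zero_mem (φ : H.root) : affineReflection φ 0 ∈ coxeterGroup b := by
  refine b.induction_reflect φ (p := fun φ => affineReflection φ 0 ∈ coxeterGroup b)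
    (fun φ hφ => ?_) (fun α hα => Subgroup.subset_closure (Or.inl ⟨α, hα, rfl⟩))
    fun φ α hφ hα => ?_
  · have := affineReflection_neg φ 0
    rw [neg_zero] at this
    exact this ▸ hφ
  · have hs : affineReflection α 0 ∈ coxeterGroup b :=
      Subgroup.subset_closure (Or.inl ⟨α, hα, rfl⟩)
    have h1 := (permutesAffineForms_affineReflection α 0).conj_affineReflection
      (reflPerm α φ) 0
    rw [reflPerm_reflPerm, zero_mul, add_zero] at h1
    exact h1 ▸ mul_mem (mul_mem hs hφ) (inv_mem hs)

/-- The vectors of the translations in the group generated by the Coxeter generators. -/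
def translationVectors : AddSubgroup (realCartan H) where
  carrier := {v | AffineEquiv.constVAdd ℝ (realCartan H) v ∈ coxeterGroup b}
  add_mem' {v w} hv hw := by
    have : AffineEquiv.constVAdd ℝ (realCartan H) (v + w) =
        AffineEquiv.constVAdd ℝ (realCartan H) v * AffineEquiv.constVAdd ℝ (realCartan H) w :=
      AffineEquiv.ext fun x => add_vadd v w x
    change AffineEquiv.constVAdd ℝ (realCartan H) (v + w) ∈ coxeterGroup b
    rw [this]
    exact mul_mem hv hw
  zero_mem' := by
    change AffineEquiv.constVAdd ℝ (realCartan H) 0 ∈ coxeterGroup b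
    rw [AffineEquiv.constVAdd_zero]
    exact one_mem _
  neg_mem' {v} hv := by
    have : AffineEquiv.constVAdd ℝ (realCartan H) (-v) =
        (AffineEquiv.constVAdd ℝ (realCartan H) v)⁻¹ := AffineEquiv.ext fun x => rfl
    change AffineEquiv.constVAdd ℝ (realCartan H) (-v) ∈ coxeterGroup b
    rw [this]
    exact inv_mem hv

lemma mem_translationVectors {v : realCartan H} : v ∈ translationVectors b ↔
    AffineEquiv.constVAdd ℝ (realCartan H) v ∈ coxeterGroup b := Iff.rfl

lemma rootReflection_mem_translationVectors (φ : H.root) {v : realCartan H}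
    (hv : v ∈ translationVectors b) : rootReflection φ v ∈ translationVectors b := by
  have hs := affineReflection_zero_mem b φ
  rw [← rootReflection_toAffineEquiv] at hs
  have : AffineEquiv.constVAdd ℝ (realCartan H) (rootReflection φ v) =
      (rootReflection φ).toAffineEquiv * AffineEquiv.constVAdd ℝ (realCartan H) v *
        (rootReflection φ).toAffineEquiv⁻¹ := by
    rw [eq_mul_inv_iff_mul_eq]
    exact AffineEquiv.ext fun x => (map_add (rootReflection φ) v x).symm
  rw [mem_translationVectors, this]
  exact mul_mem (mul_mem hs hv) (inv_mem hs)

/-- The product of the reflections in the parallel walls (ψ, x) = 1 and (ψ, x) = 0 is the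
translation by ψ^∨. -/
lemma corootVec_highestRoot_mem : corootVec (highestRoot b) ∈ translationVectors b := by
  have : AffineEquiv.constVAdd ℝ (realCartan H) (corootVec (highestRoot b)) =
      affineReflection (highestRoot b) 1 * affineReflection (highestRoot b) 0 := by
    refine AffineEquiv.ext fun x => ?_
    rw [AffineEquiv.coe_mul, Function.comp_apply, affineReflection_apply (n := 1),
      affineReflection_apply]
    simp only [map_sub, map_smul, killForm_rootVec_corootVec, smul_eq_mul, Int.cast_zero,
      Int.cast_one, AffineEquiv.constVAdd_apply, vadd_eq_add]
    module
  rw [mem_translationVectors, this]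
  exact mul_mem (Subgroup.subset_closure (Or.inr rfl)) (affineReflection_zero_mem b _)

/-- The roots `β` that behave like the highest root. -/
def longRoots : Set H.root :=
  {β | corootVec β ∈ translationVectors b ∧
    ∀ φ, φ ≠ β → φ ≠ -β → cartanInt φ β = 0 ∨ cartanInt φ β = 1 ∨ cartanInt φ β = -1}

lemma highestRoot_mem_longRoots : highestRoot b ∈ longRoots b := by
  refine ⟨corootVec_highestRoot_mem b, fun φ h1 h2 => ?_⟩
  rcases isPos_or_isPos_neg b φ with hφ | hφ
  · rcases cartanInt_highestRoot hφ h1 with h | h <;> simp [h]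
  · have h3 := cartanInt_highestRoot hφ fun h => h2 (by rw [← h, neg_neg])
    rw [cartanInt_neg_left] at h3
    lia

lemma reflPerm_mem_longRoots (α : H.root) {β : H.root} (hβ : β ∈ longRoots b) :
    reflPerm α β ∈ longRoots b := by
  refine ⟨?_, fun φ h1 h2 => ?_⟩
  · rw [corootVec_reflPerm]
    exact rootReflection_mem_translationVectors b α hβ.1
  · rw [cartanInt_reflPerm_right]
    refine hβ.2 _ (fun h => h1 ?_) fun h => h2 ?_
    · rw [← h, reflPerm_reflPerm]
    · rw [← reflPerm_neg, ← h, reflPerm_reflPerm]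

/-- The set is stable under all reflections. A root α not orthogonal to some β in it is in its span,
being proportional to β − s_α β. By irreducibility the span is then everything, and no root is
orthogonal to all of it. -/
lemma exists_mem_longRoots_cartanInt_ne_zero (φ : H.root) :
    ∃ β ∈ longRoots b, cartanInt φ β ≠ 0 := by
  by_contra! h
  have hspan := (rootSystem H).span_root_image_eq_top_of_forall_orthogonal (longRoots b)
    ⟨_, highestRoot_mem_longRoots b⟩ fun α hα β hβ => by
      have hp : (rootSystem H).pairing β α = 0 := by
        by_contra hne
        have h1 := Submodule.subset_span (R := ℂ)
          (Set.mem_image_of_mem (rootSystem H).root (reflPerm_mem_longRoots b α hβ))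
        have h2 := Submodule.subset_span (R := ℂ) (Set.mem_image_of_mem (rootSystem H).root hβ)
        rw [SetLike.mem_coe, RootPairing.root_reflectionPerm, RootPairing.reflection_apply_root,
          Submodule.sub_mem_iff_right _ h2, Submodule.smul_mem_iff _ hne] at h1
        exact hα h1
      exact ⟨(rootSystem H).pairing_eq_zero_iff.mp hp, hp⟩
  have h2 : Submodule.span ℂ ((rootSystem H).root '' longRoots b) ≤
      LinearMap.ker ((rootSystem H).coroot' φ) := by
    rw [Submodule.span_le]
    rintro _ ⟨β, hβ, rfl⟩
    have h3 : (rootSystem H).pairing φ β = 0 := by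
      rw [← (rootSystem H).algebraMap_pairingIn ℤ]
      have : (rootSystem H).pairingIn ℤ φ β = 0 := h β hβ
      rw [this, map_zero]
    exact (rootSystem H).pairing_eq_zero_iff.mp h3
  rw [hspan] at h2
  have h4 : (rootSystem H).coroot' φ ((rootSystem H).root φ) = 0 := h2 Submodule.mem_top
  rw [RootPairing.root_coroot'_eq_pairing, RootPairing.pairing_same] at h4
  exact two_ne_zero h4

lemma corootVec_mem_translationVectors (φ : H.root) : corootVec φ ∈ translationVectors b := by
  obtain ⟨β, hβ, hne⟩ := exists_mem_longRoots_cartanInt_ne_zero b φ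
  by_cases h1 : φ = β
  · exact h1 ▸ hβ.1
  by_cases h2 : φ = -β
  · rw [h2, corootVec_neg]
    exact neg_mem hβ.1
  -- The translation vectors contain β^∨ − s_φ β^∨ = (φ, β^∨) φ^∨, and the coefficient is now ±1.
  have h3 := rootReflection_mem_translationVectors b φ hβ.1
  rw [rootReflection_apply, killForm_rootVec_corootVec_eq] at h3
  have h4 := sub_mem hβ.1 h3
  rw [sub_sub_cancel] at h4
  rcases (hβ.2 φ h1 h2).resolve_left hne with h | h
  · rwa [h, Int.cast_one, one_smul] at h4
  · rw [h, Int.cast_neg, Int.cast_one, neg_smul, one_smul] at h4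
    exact neg_mem_iff.mp h4

/-- The affine Weyl group is generated by the Coxeter generators. -/
lemma affineWeylGroup_le_coxeterGroup : affineWeylGroup H ≤ coxeterGroup b := by
  refine sup_le ?_ ((Subgroup.closure_le _).mpr ?_)
  · rintro _ ⟨v, hv, rfl⟩
    have h1 : corootLattice H ≤ translationVectors b := by
      rw [corootLattice, AddSubgroup.closure_le]
      rintro _ ⟨φ, rfl⟩
      exact corootVec_mem_translationVectors b φ
    exact h1 (show v.toAdd ∈ corootLattice H from hv)
  · rintro _ ⟨φ, rfl⟩
    change (rootReflection φ).toAffineEquiv ∈ coxeterGroup b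
    rw [rootReflection_toAffineEquiv]
    exact affineReflection_zero_mem b φ

end Generation

end

/-! ### Separating walls and the length function -/

section

variable {b : (rootSystem H).Base}

/-- The affine form `x ↦ (φ,x) - n` attached to `c = (φ,n)`. -/
def level (c : H.root × ℤ) (x : realCartan H) : ℝ := killForm H (rootVec c.1) x - c.2

lemma level_neg (c : H.root × ℤ) (x : realCartan H) : level (-c) x = -level c x := by
  rw [level, level, Prod.fst_neg, Prod.snd_neg, rootVec_neg, map_neg, LinearMap.neg_apply,
    Int.cast_neg]
  ring

lemma affineReflection_fst_snd_neg (c : H.root × ℤ) :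
    affineReflection (-c).1 (-c).2 = affineReflection c.1 c.2 :=
  affineReflection_neg c.1 c.2

variable (b) in
/-- The pairs `(φ,n)` whose affine form is negative on the interior of the fundamental alcove and
positive on the interior of `A_σ`. -/
def inversions (σ : realCartan H ≃ᵃ[ℝ] realCartan H) : Set (H.root × ℤ) :=
  {c | level c ((2 : ℝ) • rho b) < 0 ∧ 0 < level c (σ ((2 : ℝ) • rho b))}

/-- No integer separates two points of the open unit interval. -/
lemma mul_pos_of_mem_Ioo {v w : ℝ} (hv : 0 < v) (hv' : v < 1) (hw : 0 < w) (hw' : w < 1) (n : ℤ) :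
    0 < (v - n) * (w - n) := by
  rcases le_or_gt n 0 with h | h
  · have : (n : ℝ) ≤ 0 := by exact_mod_cast h
    exact mul_pos (by linarith) (by linarith)
  · have : (1 : ℝ) ≤ n := by exact_mod_cast h
    exact mul_pos_of_neg_of_neg (by linarith) (by linarith)

lemma level_two_rho_ne_zero (c : H.root × ℤ) : level c ((2 : ℝ) • rho b) ≠ 0 :=
  sub_ne_zero.mpr (killForm_two_rho_ne_intCast c.1 c.2)

/-- A Coxeter generator only crosses its own wall. -/
lemma exists_level_of_mem_coxeterGenerators {s : realCartan H ≃ᵃ[ℝ] realCartan H}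
    (hs : s ∈ coxeterGenerators b) : ∃ a : H.root × ℤ, s = affineReflection a.1 a.2 ∧
      level a ((2 : ℝ) • rho b) * level a (s ((2 : ℝ) • rho b)) < 0 ∧
      ∀ c, c ≠ a → c ≠ -a → 0 < level c ((2 : ℝ) • rho b) * level c (s ((2 : ℝ) • rho b)) := by
  set x := (2 : ℝ) • rho b with hx
  have hpos : ∀ φ : H.root, b.IsPos φ → 0 < killForm H (rootVec φ) x :=
    fun φ hφ => killForm_two_rho_pos hφ
  have hlt : ∀ φ : H.root, killForm H (rootVec φ) x < 1 := killForm_two_rho_lt_one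
  suffices h : ∃ a : H.root × ℤ, s = affineReflection a.1 a.2 ∧ level a x * level a (s x) < 0 ∧
      ∀ c : H.root × ℤ, b.IsPos c.1 → c ≠ a → 0 < level c x * level c (s x) by
    obtain ⟨a, ha, hax, h⟩ := h
    refine ⟨a, ha, hax, fun c h1 h2 => ?_⟩
    rcases isPos_or_isPos_neg b c.1 with hc | hc
    · exact h c hc h1
    · have := h (-c) hc fun h => h2 (by rw [← h, neg_neg])
      rwa [level_neg, level_neg, neg_mul_neg] at this
  rcases hs with ⟨α, hα, rfl⟩ | rfl
  · have hform (φ) (x) : killForm H (rootVec φ) (affineReflection α 0 x) =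
        killForm H (rootVec (reflPerm α φ)) x := by
      rw [(permutesAffineForms_affineReflection α 0).1 φ x]
      simp only [zero_mul, Int.cast_zero, add_zero]
    have hα0 := hpos α (isPos_of_mem_support hα)
    have hα1 := hlt α
    have hself : killForm H (rootVec α) (affineReflection α 0 x) = -killForm H (rootVec α) x := by
      rw [hform, reflPerm_self, rootVec_neg, map_neg, LinearMap.neg_apply]
    refine ⟨(α, 0), rfl, ?_, fun ⟨φ, n⟩ hφ hne => ?_⟩
    · simp only [level, hself]
      push_cast
      nlinarith
    -- For φ = α both values are in (−1, 1), where 0 is the only integer; any other positive φ is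
    -- sent to a positive root, so both values are in (0, 1).
    · by_cases h : φ = α
      · subst h
        have hn : n ≠ 0 := fun h => hne (by rw [h])
        simp only [level, hself]
        rcases lt_or_gt_of_ne hn with h | h
        · have : (n : ℝ) ≤ -1 := by exact_mod_cast Int.le_sub_one_of_lt h
          exact mul_pos (by linarith) (by linarith)
        · have : (1 : ℝ) ≤ n := by exact_mod_cast h
          exact mul_pos_of_neg_of_neg (by linarith) (by linarith)
      · have h1 := isPos_reflPerm hα hφ h
        simp only [level, hform]
        exact mul_pos_of_mem_Ioo (hpos _ hφ) (hlt _) (hpos _ h1) (hlt _) n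
  · have hψ0 := hpos _ (isPos_highestRoot (b := b))
    have hψ1 := hlt (highestRoot b)
    have hself : killForm H (rootVec (highestRoot b)) (affineReflection (highestRoot b) 1 x) =
        2 - killForm H (rootVec (highestRoot b)) x := by
      rw [killForm_rootVec_affineReflection, cartanInt_self]
      push_cast
      ring
    refine ⟨(highestRoot b, 1), rfl, ?_, fun ⟨φ, n⟩ hφ hne => ?_⟩
    · simp only [level, hself]
      push_cast
      nlinarith
    -- For φ = ψ both values are in (0, 2), where 1 is the only integer.
    · by_cases h : φ = highestRoot b
      · subst h
        have hn : n ≠ 1 := fun h => hne (by rw [h])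
        simp only [level, hself]
        rcases lt_or_gt_of_ne hn with h | h
        · have : (n : ℝ) ≤ 0 := by exact_mod_cast Int.le_sub_one_of_lt h
          exact mul_pos (by linarith) (by linarith)
        · have : (2 : ℝ) ≤ n := by exact_mod_cast h
          exact mul_pos_of_neg_of_neg (by linarith) (by linarith)
      · have hval : killForm H (rootVec φ) (affineReflection (highestRoot b) 1 x) =
            killForm H (rootVec φ) x - (killForm H (rootVec (highestRoot b)) x - 1) *
              cartanInt φ (highestRoot b) := by
          rw [killForm_rootVec_affineReflection, Int.cast_one]
        have hφ0 := hpos φ hφ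
        have hφ1 := hlt φ
        rcases cartanInt_highestRoot hφ h with hk | hk
        · rw [hk, Int.cast_zero, mul_zero, sub_zero] at hval
          simp only [level, hval]
          exact mul_pos_of_mem_Ioo hφ0 hφ1 hφ0 hφ1 n
        -- The new value is (φ, x) − (ψ, x) + 1. It is less than 1 because (φ, x) < (ψ, x); equality
        -- is excluded since φ − ψ = s_ψ φ is a root and x = 2ρ lies on no wall.
        · have hle := killForm_le_highestRoot (b := b) (x := x)
            (fun α hα => (hpos α (isPos_of_mem_support hα)).le) φ
          have hne1 := killForm_two_rho_ne_intCast (b := b) (reflPerm (highestRoot b) φ) 0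
          rw [rootVec_reflPerm, hk, ← hx, Int.cast_one, one_smul, map_sub, LinearMap.sub_apply,
            Int.cast_zero, sub_ne_zero] at hne1
          have hlt' := lt_of_le_of_ne hle hne1
          rw [hk, Int.cast_one, mul_one] at hval
          simp only [level, hval]
          exact mul_pos_of_mem_Ioo hφ0 hφ1 (by linarith) (by linarith) n

lemma mul_self_of_mem_coxeterGenerators {s : realCartan H ≃ᵃ[ℝ] realCartan H}
    (hs : s ∈ coxeterGenerators b) : s * s = 1 := by
  obtain ⟨a, rfl, -⟩ := exists_level_of_mem_coxeterGenerators hs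
  exact affineReflection_mul_self _ _

lemma coxeterGenerators_subset : coxeterGenerators b ⊆ affineWeylGroup H := by
  have h0 : ∀ α : H.root, affineReflection α 0 ∈ affineWeylGroup H := fun α => by
    rw [← rootReflection_toAffineEquiv]
    exact Subgroup.mem_sup_right (Subgroup.subset_closure ⟨α, rfl⟩)
  rintro s (⟨α, -, rfl⟩ | rfl)
  · exact h0 α
  · have h1 := h0 (highestRoot b)
    rw [← rootReflection_toAffineEquiv] at h1
    refine mul_mem (Subgroup.mem_sup_left ⟨.ofAdd ((1 : ℤ) • corootVec (highestRoot b)), ?_, rfl⟩) h1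
    exact zsmul_mem (AddSubgroup.subset_closure ⟨_, rfl⟩ : _ ∈ corootLattice H) 1

/-- The alcoves `A_σ` and `A_{σs}` are separated by exactly one wall. -/
lemma exists_unique_crossing {σ s : realCartan H ≃ᵃ[ℝ] realCartan H} (hσ : σ ∈ affineWeylGroup H)
    (hs : s ∈ coxeterGenerators b) : ∃ a : H.root × ℤ, level a ((2 : ℝ) • rho b) < 0 ∧
      affineReflection a.1 a.2 * σ = σ * s ∧
      level a (σ ((2 : ℝ) • rho b)) * level a ((σ * s) ((2 : ℝ) • rho b)) < 0 ∧
      ∀ c, level c ((2 : ℝ) • rho b) < 0 → c ≠ a →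
        0 < level c (σ ((2 : ℝ) • rho b)) * level c ((σ * s) ((2 : ℝ) • rho b)) := by
  obtain ⟨⟨θ, k⟩, hs1, hs2, hs3⟩ := exists_level_of_mem_coxeterGenerators hs
  obtain ⟨π, m, h⟩ := exists_permutesAffineForms hσ
  have hlev : ∀ (c : H.root × ℤ) x, level c (σ x) = level (π c.1, c.2 - m c.1) x := by
    intro c x
    simp only [level, h.1]
    push_cast
    ring
  have hmul : ∀ x, (σ * s) x = σ (s x) := fun _ => rfl
  -- The wall of s is carried by σ to the wall of (φ, k + m φ); of the two opposite affine forms of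
  -- this wall, a is the one negative at 2ρ.
  set φ := π.symm θ with hφ
  have hθ : π φ = θ := π.apply_symm_apply θ
  suffices hmain : ∃ a : H.root × ℤ, level a ((2 : ℝ) • rho b) < 0 ∧
      (a = (φ, k + m φ) ∨ a = -(φ, k + m φ)) by
    obtain ⟨a, ha, ha'⟩ := hmain
    refine ⟨a, ha, ?_, ?_, fun c hc hca => ?_⟩
    · have h1 : affineReflection a.1 a.2 = affineReflection φ (k + m φ) := by
        rcases ha' with rfl | rfl
        · rfl
        · exact affineReflection_fst_snd_neg _
      rw [h1, hs1, ← h.mul_affineReflection, hθ]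
    · have h1 : level (φ, k + m φ) (σ ((2 : ℝ) • rho b)) *
          level (φ, k + m φ) ((σ * s) ((2 : ℝ) • rho b)) < 0 := by
        rw [hmul, hlev, hlev]
        simpa only [hθ, add_sub_cancel_right] using hs2
      rcases ha' with rfl | rfl
      · exact h1
      · rwa [level_neg, level_neg, neg_mul_neg]
    · have hcne : c ≠ -a := fun h => by
        rw [h, level_neg] at hc
        linarith
      have key : c ≠ (φ, k + m φ) ∧ c ≠ -(φ, k + m φ) := by
        rcases ha' with rfl | rfl
        · exact ⟨hca, hcne⟩
        · exact ⟨by rwa [neg_neg] at hcne, hca⟩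
      rw [hmul, hlev, hlev]
      refine hs3 _ (fun h1 => key.1 ?_) fun h1 => key.2 ?_
      · obtain ⟨h2, h3⟩ := Prod.ext_iff.mp h1
        have h4 : c.1 = φ := π.injective (h2.trans hθ.symm)
        refine Prod.ext h4 ?_
        simp only [h4] at h3 ⊢
        lia
      · obtain ⟨h2, h3⟩ := Prod.ext_iff.mp h1
        have h4 : c.1 = -φ := π.injective (by rw [h.map_neg_perm, hθ]; exact h2)
        refine Prod.ext h4 ?_
        simp only [h4, h.map_neg_int, Prod.snd_neg] at h3 ⊢
        lia
  rcases lt_or_gt_of_ne (level_two_rho_ne_zero (b := b) (φ, k + m φ)) with h1 | h1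
  · exact ⟨_, h1, Or.inl rfl⟩
  · exact ⟨_, by rw [level_neg]; linarith, Or.inr rfl⟩

lemma list_prod_mem_affineWeylGroup {l : List (realCartan H ≃ᵃ[ℝ] realCartan H)}
    (hl : ∀ s ∈ l, s ∈ coxeterGenerators b) : l.prod ∈ affineWeylGroup H :=
  list_prod_mem fun s hs => coxeterGenerators_subset (hl s hs)

/-- The reflection in a wall separating `A_σ` from the fundamental alcove deletes a letter of a
word for `σ`. -/
lemma exists_deletion {l : List (realCartan H ≃ᵃ[ℝ] realCartan H)}
    (hl : ∀ s ∈ l, s ∈ coxeterGenerators b) {c : H.root × ℤ} (hc : c ∈ inversions b l.prod) :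
    ∃ l₁ s l₂, l = l₁ ++ s :: l₂ ∧ affineReflection c.1 c.2 * l.prod = (l₁ ++ l₂).prod := by
  induction l using List.reverseRecOn with
  | nil => exact absurd (hc.1.trans hc.2) (lt_irrefl _)
  | append_singleton l s ih =>
    have hl' : ∀ s ∈ l, s ∈ coxeterGenerators b := fun s hs => hl s (by simp [hs])
    have hs : s ∈ coxeterGenerators b := hl s (by simp)
    rw [List.prod_append, List.prod_singleton] at hc ⊢
    by_cases h : 0 < level c (l.prod ((2 : ℝ) • rho b))
    · obtain ⟨l₁, s', l₂, rfl, h1⟩ := ih hl' ⟨hc.1, h⟩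
      refine ⟨l₁, s', l₂ ++ [s], by simp, ?_⟩
      rw [← mul_assoc, h1, ← List.append_assoc, List.prod_append (l₂ := [s]), List.prod_singleton]
    -- The wall of c is crossed only by the last letter, so c is the wall attached to that letter.
    · obtain ⟨a, -, ha1, -, ha2⟩ := exists_unique_crossing (list_prod_mem_affineWeylGroup hl') hs
      by_cases hca : c = a
      · refine ⟨l, s, [], rfl, ?_⟩
        rw [hca, ← mul_assoc, ha1, mul_assoc, mul_self_of_mem_coxeterGenerators hs,
          List.append_nil, mul_one]
      · have h1 := ha2 c hc.1 hca
        exact absurd (pos_of_mul_pos_left h1 hc.2.le) h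

/-- In a shortest word each new letter adds one separating wall. If the letter instead crossed back
through an earlier wall, the deletion lemma would give a shorter word. -/
lemma encard_inversions_of_minimal {l : List (realCartan H ≃ᵃ[ℝ] realCartan H)}
    (hl : ∀ s ∈ l, s ∈ coxeterGenerators b)
    (hmin : ∀ l' : List (realCartan H ≃ᵃ[ℝ] realCartan H), (∀ s ∈ l', s ∈ coxeterGenerators b) →
      l'.prod = l.prod → l.length ≤ l'.length) :
    (inversions b l.prod).encard = l.length := by
  induction l using List.reverseRecOn with
  | nil =>
    have : inversions b (List.prod []) = ∅ :=
      Set.eq_empty_of_forall_notMem fun c hc => absurd (hc.1.trans hc.2) (lt_irrefl _)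
    rw [this]
    simp
  | append_singleton l s ih =>
    have hl' : ∀ s ∈ l, s ∈ coxeterGenerators b := fun s hs => hl s (by simp [hs])
    have hs : s ∈ coxeterGenerators b := hl s (by simp)
    have hmin' : ∀ l' : List (realCartan H ≃ᵃ[ℝ] realCartan H),
        (∀ s ∈ l', s ∈ coxeterGenerators b) → l'.prod = l.prod → l.length ≤ l'.length := by
      intro l' h1 h2
      have := hmin (l' ++ [s]) (fun t ht => by
        rcases List.mem_append.mp ht with h | h
        · exact h1 t h
        · rw [List.mem_singleton.mp h]; exact hs) (by simp [h2])
      simpa using this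
    obtain ⟨a, ha0, ha1, ha2, ha3⟩ := exists_unique_crossing (list_prod_mem_affineWeylGroup hl') hs
    have hnot : a ∉ inversions b l.prod := by
      intro ha
      obtain ⟨l₁, s', l₂, rfl, h1⟩ := exists_deletion hl' ha
      have := hmin (l₁ ++ l₂) (fun t ht => hl' t (by
        rcases List.mem_append.mp ht with h | h <;> simp [h]))
        (by rw [← h1, ha1, List.prod_append (l₂ := [s]), List.prod_singleton])
      simp only [List.length_append, List.length_cons, List.length_nil] at this
      lia
    have hins : inversions b (l ++ [s]).prod = insert a (inversions b l.prod) := by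
      rw [List.prod_append, List.prod_singleton]
      ext c
      rw [Set.mem_insert_iff]
      by_cases hca : c = a
      · subst hca
        simp only [true_or, iff_true]
        refine ⟨ha0, ?_⟩
        have h1 : level c (l.prod ((2 : ℝ) • rho b)) ≤ 0 := not_lt.mp fun h => hnot ⟨ha0, h⟩
        by_contra! h2
        exact absurd ha2 (not_lt.mpr (mul_nonneg_of_nonpos_of_nonpos h1 h2))
      · simp only [hca, false_or]
        refine and_congr_right fun hc => ?_
        have h1 := ha3 c hc hca
        exact ⟨fun h => pos_of_mul_pos_left h1 h.le, fun h => pos_of_mul_pos_right h1 h.le⟩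
    rw [hins, Set.encard_insert_of_notMem hnot, ih hl' hmin']
    simp

/-- The length of `σ` is the number of walls separating `A_σ` from the fundamental alcove. -/
lemma encard_inversions {σ : realCartan H ≃ᵃ[ℝ] realCartan H} (hσ : σ ∈ affineWeylGroup H) :
    (inversions b σ).encard = length b σ := by
  -- The infimum of the empty set would be the default 0, so a word for σ has to exist. As the
  -- generators are involutions, no inverses are needed.
  have hne : {n | ∃ l : List (realCartan H ≃ᵃ[ℝ] realCartan H),
      (∀ s ∈ l, s ∈ coxeterGenerators b) ∧ l.prod = σ ∧ l.length = n}.Nonempty := by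
    have hmem := affineWeylGroup_le_coxeterGroup b hσ
    rw [← Subgroup.mem_toSubmonoid, Subgroup.closure_toSubmonoid] at hmem
    obtain ⟨l, hl, h⟩ := Submonoid.exists_list_of_mem_closure hmem
    refine ⟨_, l, fun s hs => (hl s hs).elim id fun h => ?_, h, rfl⟩
    have := mul_self_of_mem_coxeterGenerators (Set.mem_inv.mp h)
    have hinv : s⁻¹ = s := (mul_eq_one_iff_eq_inv.mp this).trans (inv_inv s)
    exact Set.mem_of_eq_of_mem hinv.symm (Set.mem_inv.mp h)
  obtain ⟨l, hl, rfl, hlen⟩ := Nat.sInf_mem hne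
  rw [encard_inversions_of_minimal hl fun l' h1 h2 => ?_, hlen, length]
  rw [hlen]
  exact Nat.sInf_le ⟨l', h1, h2, rfl⟩

lemma two_rho_mem_fundamentalAlcove : (2 : ℝ) • rho b ∈ fundamentalAlcove b :=
  ⟨fun _ hα => (killForm_two_rho_pos (isPos_of_mem_support hα)).le, (killForm_two_rho_lt_one _).le⟩

variable (b) in
/-- The integer part of `(φ, σ(2ρ))`: for a positive root `φ` and a dominant `σ`, the number of
walls `(φ,x) = n` separating `A_σ` from the fundamental alcove. -/
def wallCount (σ : realCartan H ≃ᵃ[ℝ] realCartan H) (φ : H.root) : ℤ :=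
  ⌊killForm H (rootVec φ) (σ ((2 : ℝ) • rho b))⌋

lemma killForm_map_two_rho_ne_intCast {σ : realCartan H ≃ᵃ[ℝ] realCartan H}
    (hσ : σ ∈ affineWeylGroup H) (φ : H.root) (n : ℤ) :
    killForm H (rootVec φ) (σ ((2 : ℝ) • rho b)) ≠ n := by
  obtain ⟨π, m, h⟩ := exists_permutesAffineForms hσ
  rw [h.1]
  intro h1
  refine killForm_two_rho_ne_intCast (b := b) (π φ) (n - m φ) ?_
  push_cast
  linarith

lemma killForm_map_two_rho_nonneg {σ : realCartan H ≃ᵃ[ℝ] realCartan H}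
    (hσ : σ ∈ dominantElements b) {φ : H.root} (hφ : b.IsPos φ) :
    0 ≤ killForm H (rootVec φ) (σ ((2 : ℝ) • rho b)) :=
  hσ.2 ⟨_, two_rho_mem_fundamentalAlcove, rfl⟩ φ hφ

lemma wallCount_nonneg {σ : realCartan H ≃ᵃ[ℝ] realCartan H}
    (hσ : σ ∈ dominantElements b) {φ : H.root} (hφ : b.IsPos φ) : 0 ≤ wallCount b σ φ :=
  Int.floor_nonneg.mpr (killForm_map_two_rho_nonneg hσ hφ)

/-- The inversions are the pairs (φ, n) with φ positive and 1 ≤ n ≤ n_φ, because (φ, 2ρ) is in (0,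
1) and (φ, σ(2ρ)) is not an integer. -/
lemma length_eq_sum_wallCount {σ : realCartan H ≃ᵃ[ℝ] realCartan H}
    (hσ : σ ∈ dominantElements b) : (length b σ : ℤ) = ∑ φ ∈ posRoots b, wallCount b σ φ := by
  let T : Finset (H.root × ℤ) := ((posRoots b).sigma fun φ => Finset.Icc 1 (wallCount b σ φ)).map
    (Equiv.sigmaEquivProd _ _).toEmbedding
  have hT : inversions b σ = T := by
    ext ⟨φ, n⟩
    have hmem : (φ, n) ∈ (T : Set (H.root × ℤ)) ↔ b.IsPos φ ∧ 1 ≤ n ∧ n ≤ wallCount b σ φ := by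
      simp [T]
    rw [hmem, wallCount, Int.le_floor]
    simp only [inversions, level, Set.mem_ofPred_eq]
    constructor
    · rintro ⟨h1, h2⟩
      -- For negative φ the integer n would lie strictly between −1 and 0.
      have hφ : b.IsPos φ := by
        by_contra hφ
        rw [← isPos_neg_iff] at hφ
        have h3 := killForm_map_two_rho_nonneg hσ hφ
        have h4 := killForm_two_rho_lt_one (b := b) (-φ)
        rw [rootVec_neg, map_neg, LinearMap.neg_apply] at h3 h4
        have h5 : (-1 : ℝ) < n := by linarith
        have h6 : (n : ℝ) < 0 := by linarith
        have h7 : -1 < n := by exact_mod_cast h5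
        have h8 : n < 0 := by exact_mod_cast h6
        lia
      refine ⟨hφ, ?_, by linarith⟩
      have h3 := killForm_two_rho_pos hφ
      have h5 : (0 : ℝ) < n := by linarith
      have h6 : 0 < n := by exact_mod_cast h5
      lia
    · rintro ⟨hφ, h1, h2⟩
      have h3 := killForm_two_rho_lt_one (b := b) φ
      have h4 : (1 : ℝ) ≤ n := by exact_mod_cast h1
      have h5 := (killForm_map_two_rho_ne_intCast (b := b) hσ.1 φ n).symm
      exact ⟨by linarith, by linarith [lt_of_le_of_ne h2 h5]⟩
  have h1 := encard_inversions (b := b) hσ.1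
  rw [hT, Set.encard_coe_eq_coe_finsetCard, Nat.cast_inj, Finset.card_map, Finset.card_sigma] at h1
  rw [← h1]
  push_cast
  refine Finset.sum_congr rfl fun φ hφ => ?_
  have := wallCount_nonneg hσ (mem_posRoots.mp hφ)
  rw [Int.card_Icc]
  lia

end

/-! ### The weight λ^σ, its Casimir value and the length in terms of wall counts -/

section

variable {b : (rootSystem H).Base} {σ : realCartan H ≃ᵃ[ℝ] realCartan H}

open Classical in
-- The number (πφ, 2ρ) is in (0, 1) or in (−1, 0) according to the sign of πφ.
lemma PermutesAffineForms.wallCount_eq {π : Equiv.Perm H.root} {m : H.root → ℤ}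
    (h : PermutesAffineForms σ π m) (φ : H.root) :
    wallCount b σ φ = m φ + if b.IsPos (π φ) then 0 else -1 := by
  rw [wallCount, h.1, Int.floor_add_intCast, add_comm, add_right_inj]
  have h1 := killForm_two_rho_lt_one (b := b) (π φ)
  split_ifs with hφ
  · have h2 := killForm_two_rho_pos hφ
    exact Int.floor_eq_iff.mpr (by constructor <;> push_cast <;> linarith)
  · rw [← isPos_neg_iff] at hφ
    have h2 := killForm_two_rho_pos hφ
    have h3 := killForm_two_rho_lt_one (b := b) (-π φ)
    rw [rootVec_neg, map_neg, LinearMap.neg_apply] at h2 h3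
    exact Int.floor_eq_iff.mpr (by constructor <;> push_cast <;> linarith)

open Classical in
-- Expand 2ρ as the sum of the positive roots χ; as π is isometric, each χ contributes (π⁻¹χ, z).
-- This evaluates the mixed term both in σ(2ρ) and in its norm.
lemma PermutesAffineForms.sum_killForm_two_rho_mul {π : Equiv.Perm H.root} {m : H.root → ℤ}
    (h : PermutesAffineForms σ π m) (z : realCartan H) :
    ∑ φ, killForm H (rootVec (π φ)) ((2 : ℝ) • rho b) * killForm H (rootVec φ) z =
      ∑ φ, if b.IsPos (π φ) then killForm H (rootVec φ) z else 0 := by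
  have h1 (χ : H.root) : ∑ φ, killForm H (rootVec (π φ)) (rootVec χ) * killForm H (rootVec φ) z =
      killForm H (rootVec (π.symm χ)) z := by
    rw [killForm_eq_sum]
    refine Finset.sum_congr rfl fun φ _ => ?_
    conv_lhs => rw [← π.apply_symm_apply χ, h.2]
  calc _ = ∑ φ, ∑ χ ∈ posRoots b,
        killForm H (rootVec (π φ)) (rootVec χ) * killForm H (rootVec φ) z := by
        refine Finset.sum_congr rfl fun φ _ => ?_
        rw [two_smul_rho, map_sum, Finset.sum_mul]
    _ = ∑ χ ∈ posRoots b, killForm H (rootVec (π.symm χ)) z := by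
        rw [Finset.sum_comm]
        exact Finset.sum_congr rfl fun χ _ => h1 χ
    _ = ∑ χ, if b.IsPos χ then killForm H (rootVec (π.symm χ)) z else 0 := by
        rw [posRoots, Finset.sum_filter]
    _ = _ := (Fintype.sum_equiv π _ _ fun φ => by rw [π.symm_apply_apply]).symm

/-- Paired with χ, the left side is the sum over all roots of ((πφ, 2ρ) + m_φ)(φ, χ), and (πφ, 2ρ)
may be replaced by 1 or 0 according to the sign of πφ. Together φ and −φ then contribute 2n_φ + 1
times (φ, χ). -/
lemma map_two_rho_eq_sum (hσ : σ ∈ affineWeylGroup H) : σ ((2 : ℝ) • rho b) =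
    ∑ φ ∈ posRoots b, (2 * (wallCount b σ φ : ℝ) + 1) • rootVec φ := by
  classical
  obtain ⟨π, m, h⟩ := exists_permutesAffineForms hσ
  refine ext_killForm fun χ => ?_
  rw [killForm_comm, killForm_comm (rootVec χ), map_sum, LinearMap.sum_apply, killForm_eq_sum]
  simp_rw [h.1, add_mul]
  rw [Finset.sum_add_distrib, h.sum_killForm_two_rho_mul, ← Finset.sum_add_distrib,
    sum_eq_sum_posRoots (b := b)]
  refine Finset.sum_congr rfl fun φ _ => ?_
  rw [h.map_neg_perm, h.map_neg_int, h.wallCount_eq, rootVec_neg, map_smul]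
  simp only [map_neg, LinearMap.neg_apply, LinearMap.smul_apply, smul_eq_mul, isPos_neg_iff]
  by_cases hφ : b.IsPos (π φ)
  · simp only [hφ, not_true_eq_false, if_true, if_false]
    push_cast
    ring
  · simp only [hφ, not_false_eq_true, if_true, if_false]
    push_cast
    ring

/-- The weight `λ^σ` is the sum of the positive roots `φ`, each taken as many times as there are
walls `(φ,x) = n` separating `A_σ` from the fundamental alcove. -/
lemma alcoveWeight_eq_sum (hσ : σ ∈ affineWeylGroup H) :
    alcoveWeight b σ = ∑ φ ∈ posRoots b, (wallCount b σ φ : ℝ) • rootVec φ := by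
  have h2 : rho b = (1 / 2 : ℝ) • ∑ φ ∈ posRoots b, rootVec φ := by
    rw [← two_smul_rho, smul_smul]
    norm_num
  rw [alcoveWeight, map_two_rho_eq_sum hσ, h2, ← smul_sub, ← Finset.sum_sub_distrib,
    Finset.smul_sum]
  refine Finset.sum_congr rfl fun φ _ => ?_
  module

/-- As λ^σ + ρ = σ(2ρ)/2, the value is a quarter of |σ(2ρ)|² − |2ρ|². Written as sums of squares
over the roots, the squares of (πφ, 2ρ) cancel, and φ and −φ together leave 2n_φ(n_φ + 1). -/
lemma two_mul_cas_alcoveWeight (hσ : σ ∈ affineWeylGroup H) : 2 * cas b (alcoveWeight b σ) =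
    ∑ φ ∈ posRoots b, (wallCount b σ φ : ℝ) * (wallCount b σ φ + 1) := by
  classical
  obtain ⟨π, m, h⟩ := exists_permutesAffineForms hσ
  set x := (2 : ℝ) • rho b with hx
  have hρ : rho b = (1 / 2 : ℝ) • x := by
    rw [hx, smul_smul]
    norm_num
  have h1 : cas b (alcoveWeight b σ) =
      (1 / 4) * (killForm H (σ x) (σ x) - killForm H x x) := by
    rw [cas, alcoveWeight, sub_add_cancel, hρ]
    simp only [map_smul, LinearMap.smul_apply, smul_eq_mul, smul_smul]
    norm_num
    ring
  have hxx : killForm H x x = ∑ φ, killForm H (rootVec (π φ)) x * killForm H (rootVec (π φ)) x := by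
    rw [killForm_eq_sum]
    exact (Fintype.sum_equiv π _ _ fun φ => rfl).symm
  have hcross : ∑ φ, killForm H (rootVec (π φ)) x * (m φ : ℝ) =
      ∑ φ, if b.IsPos (π φ) then (m φ : ℝ) else 0 := by
    have := h.sum_killForm_two_rho_mul (b := b) (σ 0)
    simpa only [h.killForm_map_zero] using this
  have h2 : killForm H (σ x) (σ x) - killForm H x x =
      ∑ φ, (2 * (if b.IsPos (π φ) then (m φ : ℝ) else 0) + (m φ : ℝ) ^ 2) := by
    rw [Finset.sum_add_distrib, ← Finset.mul_sum, ← hcross, hxx, killForm_eq_sum,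
      ← Finset.sum_sub_distrib, Finset.mul_sum, ← Finset.sum_add_distrib]
    refine Finset.sum_congr rfl fun φ _ => ?_
    rw [h.1]
    ring
  rw [h1, h2, sum_eq_sum_posRoots (b := b), Finset.mul_sum, Finset.mul_sum]
  refine Finset.sum_congr rfl fun φ _ => ?_
  rw [h.map_neg_perm, h.map_neg_int, h.wallCount_eq]
  simp only [isPos_neg_iff]
  by_cases hφ : b.IsPos (π φ)
  · simp only [hφ, not_true_eq_false, if_true, if_false]
    push_cast
    ring
  · simp only [hφ, not_false_eq_true, if_true, if_false]
    push_cast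
    ring

lemma two_mul_cas_sub_length (hσ : σ ∈ dominantElements b) :
    2 * (cas b (alcoveWeight b σ) - length b σ) =
      ∑ φ ∈ posRoots b, (wallCount b σ φ : ℝ) * (wallCount b σ φ - 1) := by
  have h1 : (length b σ : ℝ) = ∑ φ ∈ posRoots b, (wallCount b σ φ : ℝ) := by
    exact_mod_cast length_eq_sum_wallCount hσ
  rw [mul_sub, two_mul_cas_alcoveWeight hσ.1, h1, Finset.mul_sum, ← Finset.sum_sub_distrib]
  exact Finset.sum_congr rfl fun φ _ => by ring

lemma intCast_mul_sub_one_nonneg (n : ℤ) : (0 : ℝ) ≤ n * (n - 1) := by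
  have : 0 ≤ n * (n - 1) := by
    rcases le_or_gt n 0 with h | h
    · exact mul_nonneg_of_nonpos_of_nonpos h (by lia)
    · exact mul_nonneg h.le (by lia)
  exact_mod_cast this

lemma length_le_cas (hσ : σ ∈ dominantElements b) :
    (length b σ : ℝ) ≤ cas b (alcoveWeight b σ) := by
  have h1 := two_mul_cas_sub_length hσ
  have h2 : 0 ≤ ∑ φ ∈ posRoots b, (wallCount b σ φ : ℝ) * (wallCount b σ φ - 1) :=
    Finset.sum_nonneg fun φ _ => intCast_mul_sub_one_nonneg _
  linarith

lemma killForm_le_one_of_mem_fundamentalAlcove {x : realCartan H} (hx : x ∈ fundamentalAlcove b)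
    (φ : H.root) : killForm H (rootVec φ) x ≤ 1 :=
  (killForm_le_highestRoot hx.1 φ).trans hx.2

/-- Forwards, ψ dominates the other roots at σ(2ρ), which is not on the wall (ψ, x) = 2. Backwards,
n_ψ ≤ 1 bounds m_ψ, and this bounds (ψ, ·) on the whole alcove. -/
lemma mem_truncatedElements_two_iff (hσ : σ ∈ dominantElements b) :
    σ ∈ truncatedElements b 2 ↔ ∀ φ, b.IsPos φ → wallCount b σ φ ≤ 1 := by
  classical
  constructor
  · intro h φ hφ
    have h1 := (h.2 ⟨_, two_rho_mem_fundamentalAlcove, rfl⟩).2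
    have h2 : killForm H (rootVec (highestRoot b)) (σ ((2 : ℝ) • rho b)) < 2 :=
      lt_of_le_of_ne (by exact_mod_cast h1)
        (by exact_mod_cast killForm_map_two_rho_ne_intCast (b := b) hσ.1 _ 2)
    have h3 := killForm_le_highestRoot (b := b) (x := σ ((2 : ℝ) • rho b))
      (fun α hα => killForm_map_two_rho_nonneg hσ (isPos_of_mem_support hα)) φ
    have h4 : wallCount b σ φ < 2 := Int.floor_lt.mpr (by push_cast; linarith)
    lia
  · intro h
    refine ⟨hσ, ?_⟩
    rintro _ ⟨x, hx, rfl⟩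
    refine ⟨hσ.2 ⟨x, hx, rfl⟩, ?_⟩
    obtain ⟨π, m, hform⟩ := exists_permutesAffineForms hσ.1
    have h1 := h _ isPos_highestRoot
    rw [hform.wallCount_eq] at h1
    rw [hform.1]
    push_cast
    split_ifs at h1 with hpos
    · have h2 : (m (highestRoot b) : ℝ) ≤ 1 := by exact_mod_cast (by lia : m (highestRoot b) ≤ 1)
      linarith [killForm_le_one_of_mem_fundamentalAlcove hx (π (highestRoot b))]
    · have h2 : (m (highestRoot b) : ℝ) ≤ 2 := by exact_mod_cast (by lia : m (highestRoot b) ≤ 2)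
      rw [← isPos_neg_iff] at hpos
      have h3 := killForm_nonneg_of_isPos hpos hx.1
      rw [rootVec_neg, map_neg, LinearMap.neg_apply] at h3
      linarith

lemma cas_eq_length_iff (hσ : σ ∈ dominantElements b) :
    cas b (alcoveWeight b σ) = length b σ ↔ σ ∈ truncatedElements b 2 := by
  have h1 := two_mul_cas_sub_length hσ
  rw [mem_truncatedElements_two_iff hσ, ← sub_eq_zero, ← mul_eq_zero_iff_left (two_ne_zero' ℝ), h1,
    Finset.sum_eq_zero_iff_of_nonneg fun φ _ => intCast_mul_sub_one_nonneg _]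
  refine forall_congr' fun φ => ?_
  rw [mem_posRoots]
  refine forall_congr' fun hφ => ?_
  have h2 := wallCount_nonneg hσ hφ
  rw [mul_eq_zero, sub_eq_zero, Int.cast_eq_zero, Int.cast_eq_one]
  lia

end

/-! ### Abelian ideals of the Borel subalgebra -/

section

variable {b : (rootSystem H).Base}

lemma exists_rootSpace_eq_span (φ : H.root) :
    ∃ e : 𝔤, e ≠ 0 ∧ (rootSpace H φ.1).toSubmodule = Submodule.span ℂ {e} := by
  obtain ⟨e, he, he0⟩ := φ.1.exists_ne_zero
  refine ⟨e, he0, (Submodule.eq_of_le_of_finrank_eq ?_ ?_).symm⟩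
  · rwa [Submodule.span_singleton_le_iff_mem]
  · rw [finrank_span_singleton he0]
    exact (finrank_rootSpace_eq_one φ.1 (LieSubalgebra.isNonZero_coe_root φ)).symm

/-- A root vector `e_φ`. -/
def rootElt (φ : H.root) : 𝔤 := (exists_rootSpace_eq_span φ).choose

lemma rootElt_ne_zero (φ : H.root) : rootElt φ ≠ 0 := (exists_rootSpace_eq_span φ).choose_spec.1

lemma rootSpace_eq_span (φ : H.root) :
    (rootSpace H φ.1).toSubmodule = Submodule.span ℂ {rootElt φ} :=
  (exists_rootSpace_eq_span φ).choose_spec.2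

lemma rootElt_mem (φ : H.root) : rootElt φ ∈ rootSpace H φ.1 := by
  rw [← LieSubmodule.mem_toSubmodule, rootSpace_eq_span]
  exact Submodule.mem_span_singleton_self _

lemma rootSpace_le_iff {φ : H.root} {N : Submodule ℂ 𝔤} :
    (rootSpace H φ.1).toSubmodule ≤ N ↔ rootElt φ ∈ N := by
  rw [rootSpace_eq_span, Submodule.span_singleton_le_iff_mem]

lemma linearIndependent_rootElt : LinearIndependent ℂ (rootElt (H := H)) := by
  have h1 := (iSupIndep_genWeightSpace' ℂ H 𝔤).comp
    (Subtype.val_injective (p := fun α => α ∈ H.root))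
  rw [← LieSubmodule.iSupIndep_toSubmodule] at h1
  exact h1.linearIndependent _ rootElt_mem rootElt_ne_zero

/-- The sum of the root spaces of a set of roots. -/
def rootSubspace (Φ : Finset H.root) : LieSubmodule ℂ H 𝔤 := ⨆ φ : Φ, rootSpace H φ.1.1

lemma rootSubspace_toSubmodule (Φ : Finset H.root) :
    (rootSubspace Φ).toSubmodule = Submodule.span ℂ (rootElt '' (Φ : Set H.root)) := by
  rw [rootSubspace, LieSubmodule.iSup_toSubmodule, Set.image_eq_range, Submodule.span_range_eq_iSup]
  exact iSup_congr fun φ => rootSpace_eq_span φ.1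

lemma rootSpace_le_rootSubspace_iff {Φ : Finset H.root} {φ : H.root} :
    (rootSpace H φ.1).toSubmodule ≤ (rootSubspace Φ).toSubmodule ↔ φ ∈ Φ := by
  rw [rootSpace_le_iff, rootSubspace_toSubmodule]
  refine ⟨fun h => ?_, fun h => Submodule.subset_span ⟨φ, h, rfl⟩⟩
  by_contra hφ
  exact linearIndependent_rootElt.notMem_span_image (s := (Φ : Set H.root)) hφ h

lemma finrank_rootSubspace (Φ : Finset H.root) :
    Module.finrank ℂ (rootSubspace Φ).toSubmodule = Φ.card := by
  rw [rootSubspace_toSubmodule, Set.image_eq_range, finrank_span_eq_card]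
  · simp
  · exact linearIndependent_rootElt.comp _ Subtype.val_injective

lemma lie_eq_zero_or_mem_rootSpace {α β : H.root} (hα : b.IsPos α) (hβ : b.IsPos β) {x y : 𝔤}
    (hx : x ∈ rootSpace H α.1) (hy : y ∈ rootSpace H β.1) :
    ⁅x, y⁆ = 0 ∨ ∃ γ : H.root, rootVec γ = rootVec α + rootVec β ∧ ⁅x, y⁆ ∈ rootSpace H γ.1 := by
  have h1 : ⁅x, y⁆ ∈ rootSpace H (α.1 + β.1 : H → ℂ) :=
    lie_mem_genWeightSpace_of_mem_genWeightSpace hx hy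
  by_cases h0 : rootSpace H (α.1 + β.1 : H → ℂ) = ⊥
  · left
    rwa [h0, LieSubmodule.mem_bot] at h1
  · right
    let γ : Weight ℂ H 𝔤 := ⟨_, h0⟩
    have hγ : γ.IsNonZero := by
      intro hz
      have hz' : (α.1 + β.1 : H → ℂ) = 0 := hz
      refine ne_neg_of_isPos hβ hα ((rootSystem H).root.injective ?_)
      rw [root_neg]
      ext h
      simpa using eq_neg_of_add_eq_zero_right (congrFun hz' h)
    refine ⟨⟨γ, by simpa using hγ⟩, rootVec_eq_add_iff.mpr ?_, h1⟩
    ext h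
    simp [γ]

lemma rootSpace_le_borel {φ : H.root} (hφ : b.IsPos φ) :
    (rootSpace H φ.1).toSubmodule ≤ (borel b).toSubmodule :=
  (le_iSup (fun α : {α : H.root // b.IsPos α} => rootSpace H α.1.1) ⟨φ, hφ⟩).trans
    (le_sup_right : _ ≤ borelSubmodule b)

lemma cartan_le_borel (h : H) : (h : 𝔤) ∈ borel b :=
  (le_sup_left : H.toLieSubmodule ≤ borelSubmodule b) h.2

lemma rootSubspace_le_borel {Φ : Finset H.root} (hpos : ∀ φ ∈ Φ, b.IsPos φ) :
    (rootSubspace Φ).toSubmodule ≤ (borel b).toSubmodule := by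
  rw [rootSubspace, LieSubmodule.iSup_toSubmodule]
  exact iSup_le fun φ => rootSpace_le_borel (hpos _ φ.2)

/-- `Φ` is stable under the addition of positive roots. -/
def IsUpwardClosed (b : (rootSystem H).Base) (Φ : Finset H.root) : Prop :=
  ∀ φ ∈ Φ, ∀ α γ : H.root, b.IsPos α → rootVec γ = rootVec α + rootVec φ → γ ∈ Φ

lemma lie_mem_rootSubspace {Φ : Finset H.root} (hpos : ∀ φ ∈ Φ, b.IsPos φ)
    (hup : IsUpwardClosed b Φ) {x y : 𝔤} (hx : x ∈ borel b) (hy : y ∈ rootSubspace Φ) :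
    ⁅x, y⁆ ∈ rootSubspace Φ := by
  have hle : ∀ φ ∈ Φ, rootSpace H φ.1 ≤ rootSubspace Φ :=
    fun φ hφ => rootSpace_le_rootSubspace_iff.mpr hφ
  have hroot : ∀ α : {α : H.root // b.IsPos α}, ∀ x ∈ rootSpace H α.1.1,
      ⁅x, y⁆ ∈ rootSubspace Φ := by
    intro α x hx
    rw [rootSubspace] at hy
    induction hy using LieSubmodule.iSup_induction' with
    | mem φ y hy =>
      rcases lie_eq_zero_or_mem_rootSpace α.2 (hpos _ φ.2) hx hy with h | ⟨γ, hγ, h⟩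
      · rw [h]
        exact zero_mem _
      · exact hle γ (hup _ φ.2 _ _ α.2 hγ) h
    | zero => simp
    | add _ _ _ _ h1 h2 => rw [lie_add]; exact add_mem h1 h2
  have hx' : x ∈ borelSubmodule b := hx
  obtain ⟨h, hh, r, hr, rfl⟩ := (LieSubmodule.mem_sup _ _ _).mp hx'
  rw [add_lie]
  refine add_mem ((rootSubspace Φ).lie_mem (x := (⟨h, hh⟩ : H)) hy) ?_
  clear hx hx'
  induction hr using LieSubmodule.iSup_induction' with
  | mem α x hx => exact hroot α x hx
  | zero => simp
  | add _ _ _ _ h1 h2 => rw [add_lie]; exact add_mem h1 h2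

/-- The ideal of `𝔟` spanned by the root spaces of an upward closed set of positive roots. -/
def rootIdeal (Φ : Finset H.root) (hpos : ∀ φ ∈ Φ, b.IsPos φ) (hup : IsUpwardClosed b Φ) :
    LieIdeal ℂ (borel b) :=
  { (rootSubspace Φ).toSubmodule.comap (borel b).toSubmodule.subtype with
    lie_mem := fun {x} {_} hm => lie_mem_rootSubspace hpos hup x.2 hm }

lemma idealSubspace_rootIdeal {Φ : Finset H.root} (hpos : ∀ φ ∈ Φ, b.IsPos φ)
    (hup : IsUpwardClosed b Φ) :
    idealSubspace b (rootIdeal Φ hpos hup) = (rootSubspace Φ).toSubmodule := by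
  change ((rootSubspace Φ).toSubmodule.comap (borel b).toSubmodule.subtype).map
    (borel b).toSubmodule.subtype = _
  rw [Submodule.map_comap_subtype]
  exact inf_eq_right.mpr (rootSubspace_le_borel hpos)

lemma isLieAbelian_rootIdeal {Φ : Finset H.root} (hpos : ∀ φ ∈ Φ, b.IsPos φ)
    (hup : IsUpwardClosed b Φ)
    (hadd : ∀ φ ∈ Φ, ∀ χ ∈ Φ, ∀ γ : H.root, rootVec γ ≠ rootVec φ + rootVec χ) :
    IsLieAbelian (rootIdeal Φ hpos hup) := by
  have key : ∀ x ∈ rootSubspace Φ, ∀ y ∈ rootSubspace Φ, ⁅x, y⁆ = 0 := by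
    intro x hx y hy
    rw [rootSubspace] at hx hy
    induction hx using LieSubmodule.iSup_induction' with
    | mem φ x hx =>
      induction hy using LieSubmodule.iSup_induction' with
      | mem χ y hy =>
        rcases lie_eq_zero_or_mem_rootSpace (hpos _ φ.2) (hpos _ χ.2) hx hy with h | ⟨γ, hγ, -⟩
        · exact h
        · exact absurd hγ (hadd _ φ.2 _ χ.2 γ)
      | zero => simp
      | add _ _ _ _ h1 h2 => rw [lie_add, h1, h2, add_zero]
    | zero => simp
    | add _ _ _ _ h1 h2 => rw [add_lie, h1, h2, add_zero]
  exact ⟨fun x y => Subtype.ext (Subtype.ext (key _ x.2 _ y.2))⟩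

lemma idealSubspace_injective : Function.Injective (idealSubspace b) := fun _ _ h =>
  LieSubmodule.toSubmodule_injective
    (Submodule.map_injective_of_injective (borel b).toSubmodule.injective_subtype h)

lemma finrank_idealSubspace (𝔞 : LieIdeal ℂ (borel b)) :
    Module.finrank ℂ (idealSubspace b 𝔞) = Module.finrank ℂ 𝔞 :=
  (Submodule.equivMapOfInjective _ (borel b).toSubmodule.injective_subtype
    𝔞.toSubmodule).finrank_eq.symm

open Classical in
/-- The roots whose root space is contained in an ideal of `𝔟`. -/
def idealRoots (𝔞 : LieIdeal ℂ (borel b)) : Finset H.root :=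
  Finset.univ.filter fun φ => (rootSpace H φ.1).toSubmodule ≤ idealSubspace b 𝔞

lemma mem_idealRoots {𝔞 : LieIdeal ℂ (borel b)} {φ : H.root} :
    φ ∈ idealRoots 𝔞 ↔ (rootSpace H φ.1).toSubmodule ≤ idealSubspace b 𝔞 := by
  simp [idealRoots]

lemma idealWeight_eq_sum (𝔞 : LieIdeal ℂ (borel b)) :
    idealWeight b 𝔞 = ∑ φ ∈ idealRoots 𝔞, rootVec φ := rfl

lemma lie_mem_idealSubspace (𝔞 : LieIdeal ℂ (borel b)) {x y : 𝔤} (hx : x ∈ borel b)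
    (hy : y ∈ idealSubspace b 𝔞) : ⁅x, y⁆ ∈ idealSubspace b 𝔞 := by
  obtain ⟨y, hy, rfl⟩ := hy
  exact ⟨⁅(⟨x, hx⟩ : borel b), y⁆, lie_mem_right ℂ (borel b) 𝔞 _ _ hy, rfl⟩

lemma lie_eq_zero_of_isLieAbelian {𝔞 : LieIdeal ℂ (borel b)} (h𝔞 : IsLieAbelian 𝔞) {x y : 𝔤}
    (hx : x ∈ idealSubspace b 𝔞) (hy : y ∈ idealSubspace b 𝔞) : ⁅x, y⁆ = 0 := by
  obtain ⟨x, hx, rfl⟩ := hx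
  obtain ⟨y, hy, rfl⟩ := hy
  have h : ⁅(⟨x, hx⟩ : 𝔞), (⟨y, hy⟩ : 𝔞)⁆ = 0 := trivial_lie_zero _ _ _ _
  exact congrArg (fun z : 𝔞 => ((z : borel b) : 𝔤)) h

lemma lie_rootElt (h : H) (φ : H.root) : ⁅(h : 𝔤), rootElt φ⁆ = φ.1 h • rootElt φ :=
  lie_eq_smul_of_mem_rootSpace (rootElt_mem φ) h

/-- An abelian ideal of `𝔟` has no nonzero element in the Cartan subalgebra. -/
lemma eq_zero_of_mem_idealSubspace {𝔞 : LieIdeal ℂ (borel b)} (h𝔞 : IsLieAbelian 𝔞) {h : H}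
    (hh : (h : 𝔤) ∈ idealSubspace b 𝔞) : h = 0 := by
  have hpos : ∀ φ : H.root, b.IsPos φ → φ.1 h = 0 := by
    intro φ hφ
    by_contra hne
    -- If φ(h) ≠ 0, the ideal contains e_φ, which does not commute with h.
    have h1 : ⁅(h : 𝔤), rootElt φ⁆ ∈ idealSubspace b 𝔞 := by
      rw [← lie_skew]
      exact neg_mem (lie_mem_idealSubspace 𝔞 (rootSpace_le_borel hφ (rootElt_mem φ)) hh)
    rw [lie_rootElt, Submodule.smul_mem_iff _ hne] at h1
    have h2 := lie_eq_zero_of_isLieAbelian h𝔞 hh h1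
    rw [lie_rootElt] at h2
    exact (smul_ne_zero hne (rootElt_ne_zero φ)) h2
  have hall : ∀ φ : H.root, φ.1 h = 0 := by
    intro φ
    rcases isPos_or_isPos_neg b φ with hφ | hφ
    · exact hpos φ hφ
    · have h1 := hpos _ hφ
      have h2 := congrArg (fun f : Module.Dual ℂ H => f h) (root_neg φ)
      have h3 : (-φ : H.root).1 h = -φ.1 h := h2
      rw [h1] at h3
      exact neg_eq_zero.mp h3.symm
  have h1 : h ∈ ⨅ α : Weight ℂ H 𝔤, α.ker := by
    refine (Submodule.mem_iInf _).mpr fun α => ?_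
    by_cases hα : α.IsZero
    · exact congrFun hα _
    · exact hall ⟨α, by simpa using hα⟩
  rwa [iInf_ker_weight_eq_bot] at h1

lemma mem_rootSpace_neg_iff {φ : H.root} {y : 𝔤} :
    y ∈ rootSpace H (-φ.1 : H → ℂ) ↔ y ∈ rootSpace H (-φ : H.root).1 := by
  have : (-φ.1 : H → ℂ) = ((-φ : H.root).1 : H → ℂ) := by
    funext h
    exact (congrArg (fun f : Module.Dual ℂ H => f h) (root_neg φ)).symm
  rw [this]

lemma killingForm_rootElt_rootElt_neg_ne_zero (φ : H.root) :
    killingForm ℂ 𝔤 (rootElt φ) (rootElt (-φ)) ≠ 0 := by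
  intro h0
  have h1 := mem_ker_killingForm_of_mem_rootSpace_of_forall_rootSpace_neg ℂ 𝔤 H (rootElt_mem φ)
    fun y hy => by
      have hy' := mem_rootSpace_neg_iff.mp hy
      rw [← LieSubmodule.mem_toSubmodule, rootSpace_eq_span, Submodule.mem_span_singleton] at hy'
      obtain ⟨c, rfl⟩ := hy'
      rw [map_smul, h0, smul_zero]
  rw [ker_killingForm_eq_bot] at h1
  exact rootElt_ne_zero φ h1

lemma lie_rootElt_rootElt_neg (φ : H.root) :
    ⁅rootElt φ, rootElt (-φ)⁆ =
      killingForm ℂ 𝔤 (rootElt φ) (rootElt (-φ)) • ((rootVec φ : H) : 𝔤) :=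
  lie_eq_killingForm_smul_of_mem_rootSpace_of_mem_rootSpace_neg (rootElt_mem φ)
    (mem_rootSpace_neg_iff.mpr (rootElt_mem (-φ)))

/-- If −φ were positive, the ideal would contain [e_φ, e_{−φ}], a nonzero multiple of the vector of
φ in the Cartan subalgebra, which does not commute with e_φ. -/
lemma isPos_of_mem_idealRoots {𝔞 : LieIdeal ℂ (borel b)} (h𝔞 : IsLieAbelian 𝔞) {φ : H.root}
    (hφ : φ ∈ idealRoots 𝔞) : b.IsPos φ := by
  rw [mem_idealRoots, rootSpace_le_iff] at hφ
  by_contra hneg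
  rw [← isPos_neg_iff] at hneg
  have h1 : ⁅rootElt φ, rootElt (-φ)⁆ ∈ idealSubspace b 𝔞 := by
    rw [← lie_skew]
    exact neg_mem (lie_mem_idealSubspace 𝔞 (rootSpace_le_borel hneg (rootElt_mem _)) hφ)
  rw [lie_rootElt_rootElt_neg,
    Submodule.smul_mem_iff _ (killingForm_rootElt_rootElt_neg_ne_zero φ)] at h1
  have h2 := lie_eq_zero_of_isLieAbelian h𝔞 h1 hφ
  rw [lie_rootElt] at h2
  exact smul_ne_zero (apply_rootVec_self_ne φ) (rootElt_ne_zero φ) h2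

/-- By 𝔰𝔩₂-theory on the α-string through φ, of length N: with x at its top, e_φ is proportional to
f^{k+1} x, and e f^{k+1} x = (k + 1)(N − k) f^k x is nonzero since k < N. -/
lemma lie_rootElt_rootElt_ne_zero {α φ γ : H.root} (h : rootVec γ = rootVec α + rootVec φ) :
    ⁅rootElt α, rootElt φ⁆ ≠ 0 := by
  have hα := LieSubalgebra.isNonZero_coe_root α
  have hγ : (γ.1 : H → ℂ) = (1 : ℤ) • (α.1 : H → ℂ) + φ.1 := by
    rw [one_smul]
    funext h'
    exact congrArg (fun f : Module.Dual ℂ H => f h') (rootVec_eq_add_iff.mp h)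
  have htop := ((rootSpace_zsmul_add_ne_bot_iff α.1 φ.1 hα 1).mp
    (hγ ▸ γ.1.genWeightSpace_ne_bot)).1
  obtain ⟨k, hk⟩ : ∃ k, chainTopCoeff α.1 φ.1 = k + 1 :=
    ⟨chainTopCoeff α.1 φ.1 - 1, by lia⟩
  have hlen := chainTopCoeff_le_chainLength α.1 φ.1
  obtain ⟨x, hx, x_ne0⟩ := (chainTop α.1 φ.1).exists_ne_zero
  obtain ⟨h, e, f, isSl2, he, hf⟩ := exists_isSl2Triple_of_weight_isNonZero hα
  obtain rfl := isSl2.h_eq_coroot hα he hf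
  have prim : isSl2.HasPrimitiveVectorWith x (chainLength α.1 φ.1 : ℂ) :=
    have := lie_mem_genWeightSpace_of_mem_genWeightSpace he hx
    ⟨x_ne0, (chainLength_smul _ _ hx).symm, by rwa [genWeightSpace_add_chainTop _ _ hα] at this⟩
  intro h0
  have h1 := prim.lie_e_pow_succ_toEnd_f k
  have h2 := toEnd_pow_apply_mem hf hx (k + 1)
  have h3 : (k + 1) • (-(α.1 : H → ℂ)) + chainTop α.1 φ.1 = φ.1 := by
    rw [coe_chainTop', hk, smul_neg, neg_add_cancel_left]
  rw [h3, ← LieSubmodule.mem_toSubmodule, rootSpace_eq_span, Submodule.mem_span_singleton] at h2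
  obtain ⟨c, hc⟩ := h2
  rw [← LieSubmodule.mem_toSubmodule, rootSpace_eq_span, Submodule.mem_span_singleton] at he
  obtain ⟨d, rfl⟩ := he
  rw [← hc, smul_lie, lie_smul, h0, smul_zero, smul_zero] at h1
  refine smul_ne_zero (mul_ne_zero (Nat.cast_add_one_ne_zero k) (sub_ne_zero.mpr ?_))
    (prim.pow_toEnd_f_ne_zero_of_eq_nat rfl (by lia)) h1.symm
  exact_mod_cast (by lia : chainLength α.1 φ.1 ≠ k)

lemma isUpwardClosed_idealRoots (𝔞 : LieIdeal ℂ (borel b)) : IsUpwardClosed b (idealRoots 𝔞) := by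
  intro φ hφ α γ hα hγ
  rw [mem_idealRoots, rootSpace_le_iff] at hφ ⊢
  have h1 := lie_mem_idealSubspace 𝔞 (rootSpace_le_borel hα (rootElt_mem α)) hφ
  have h2 : ⁅rootElt α, rootElt φ⁆ ∈ rootSpace H γ.1 := by
    have h3 : ⁅rootElt α, rootElt φ⁆ ∈ rootSpace H (α.1 + φ.1 : H → ℂ) :=
      lie_mem_genWeightSpace_of_mem_genWeightSpace (rootElt_mem α) (rootElt_mem φ)
    have h4 : (α.1 + φ.1 : H → ℂ) = γ.1 := by
      funext h
      exact (congrArg (fun f : Module.Dual ℂ H => f h) (rootVec_eq_add_iff.mp hγ)).symm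
    rwa [h4] at h3
  rw [← LieSubmodule.mem_toSubmodule, rootSpace_eq_span, Submodule.mem_span_singleton] at h2
  obtain ⟨c, hc⟩ := h2
  have hc0 : c ≠ 0 := by
    rintro rfl
    rw [zero_smul] at hc
    exact lie_rootElt_rootElt_ne_zero hγ hc.symm
  rw [← hc] at h1
  exact (Submodule.smul_mem_iff _ hc0).mp h1

/-- An abelian ideal of `𝔟` is the sum of the root spaces it contains. -/
lemma idealSubspace_eq_rootSubspace {𝔞 : LieIdeal ℂ (borel b)} (h𝔞 : IsLieAbelian 𝔞) :
    idealSubspace b 𝔞 = (rootSubspace (idealRoots 𝔞)).toSubmodule := by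
  let N : LieSubmodule ℂ H 𝔤 :=
    { idealSubspace b 𝔞 with
      lie_mem := fun {x} {_} hm => lie_mem_idealSubspace 𝔞 (cartan_le_borel x) hm }
  suffices h : N = rootSubspace (idealRoots 𝔞) from congrArg LieSubmodule.toSubmodule h
  refine le_antisymm ?_ ?_
  -- A subspace stable under the Cartan subalgebra is the sum of its intersections with the weight
  -- spaces; the one of weight 0 vanishes, and the others are zero or a full root line.
  · rw [eq_iSup_inf_genWeightSpace (N := N)]
    refine iSup_le fun χ => ?_
    by_cases hχ : χ.IsZero
    · rintro x ⟨hxN, hx⟩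
      have hx' : x ∈ rootSpace H (0 : H → ℂ) := by
        have h0 : (χ : H → ℂ) = 0 := hχ
        rw [← h0]
        exact hx
      rw [rootSpace_zero_eq] at hx'
      have h1 := eq_zero_of_mem_idealSubspace h𝔞 (h := ⟨x, hx'⟩) hxN
      have h2 : x = 0 := congrArg (fun y : H => (y : 𝔤)) h1
      rw [h2]
      exact zero_mem _
    · rintro x ⟨hxN, hx⟩
      let φ : H.root := ⟨χ, by simpa using hχ⟩
      have hx' : x ∈ (rootSpace H φ.1).toSubmodule := hx
      by_cases hx0 : x = 0
      · rw [hx0]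
        exact zero_mem _
      refine (rootSpace_le_rootSubspace_iff.mpr ?_ : (rootSpace H φ.1).toSubmodule ≤ _) hx'
      rw [mem_idealRoots, rootSpace_le_iff]
      rw [rootSpace_eq_span, Submodule.mem_span_singleton] at hx'
      obtain ⟨c, rfl⟩ := hx'
      exact (Submodule.smul_mem_iff _ fun h => hx0 (by rw [h, zero_smul])).mp hxN
  · exact iSup_le fun φ => mem_idealRoots.mp φ.2

lemma sum_rootVec_ne_zero {Φ : Finset H.root} (hpos : ∀ φ ∈ Φ, b.IsPos φ) (hne : Φ.Nonempty) :
    ∑ φ ∈ Φ, rootVec φ ≠ 0 := fun h => by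
  have h1 : 0 < killForm H (∑ φ ∈ Φ, rootVec φ) ((2 : ℝ) • rho b) := by
    rw [map_sum, LinearMap.sum_apply]
    exact Finset.sum_pos (fun φ hφ => killForm_two_rho_pos (hpos φ hφ)) hne
  rw [h, map_zero, LinearMap.zero_apply] at h1
  exact lt_irrefl _ h1

/-- An upward closed set of positive roots is determined by the sum of its elements. -/
lemma subset_of_sum_rootVec_eq {Φ Ψ : Finset H.root} (hΦ : ∀ φ ∈ Φ, b.IsPos φ)
    (hΦ' : IsUpwardClosed b Φ) (hΨ' : IsUpwardClosed b Ψ)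
    (h : ∑ φ ∈ Φ, rootVec φ = ∑ φ ∈ Ψ, rootVec φ) : Φ ⊆ Ψ := by
  classical
  by_contra hsub
  have hne : (Φ \ Ψ).Nonempty := Finset.sdiff_nonempty.mpr hsub
  have hsum : ∑ φ ∈ Φ \ Ψ, rootVec φ = ∑ φ ∈ Ψ \ Φ, rootVec φ := by
    rw [← Finset.sum_inter_add_sum_sdiff Φ Ψ, ← Finset.sum_inter_add_sum_sdiff Ψ Φ,
      Finset.inter_comm] at h
    exact add_left_cancel h
  -- The differences Φ \ Ψ and Ψ \ Φ have the same nonzero sum. Its norm is positive, so some α in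
  -- the first and β in the second satisfy (α, β) > 0, and α − β is a root. Whichever sign it has,
  -- upward closure puts α in Ψ or β in Φ.
  have hpos : 0 < killForm H (∑ φ ∈ Φ \ Ψ, rootVec φ) (∑ φ ∈ Φ \ Ψ, rootVec φ) :=
    killForm_self_pos (sum_rootVec_ne_zero (fun φ hφ => hΦ φ (Finset.mem_sdiff.mp hφ).1) hne)
  nth_rewrite 2 [hsum] at hpos
  rw [map_sum] at hpos
  obtain ⟨β, hβ, h1⟩ := Finset.exists_lt_of_sum_lt (s := Ψ \ Φ) (f := fun _ => (0 : ℝ))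
    (by simpa only [Finset.sum_const_zero] using hpos)
  rw [map_sum, LinearMap.sum_apply] at h1
  obtain ⟨α, hα, h2⟩ := Finset.exists_lt_of_sum_lt (s := Φ \ Ψ) (f := fun _ => (0 : ℝ))
    (by simpa only [Finset.sum_const_zero] using h1)
  rw [Finset.mem_sdiff] at hα hβ
  obtain ⟨γ, hγ⟩ := exists_root_sub h2 fun h => hα.2 (h ▸ hβ.1)
  rcases isPos_or_isPos_neg b γ with hγ' | hγ'
  · exact hα.2 (hΨ' β hβ.1 γ α hγ' (by rw [hγ, sub_add_cancel]))
  · refine hβ.2 (hΦ' α hα.1 (-γ) β hγ' ?_)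
    rw [rootVec_neg, hγ, neg_sub, sub_add_cancel]

lemma idealRoots_rootIdeal {Φ : Finset H.root} (hpos : ∀ φ ∈ Φ, b.IsPos φ)
    (hup : IsUpwardClosed b Φ) : idealRoots (rootIdeal Φ hpos hup) = Φ := by
  ext φ
  rw [mem_idealRoots, idealSubspace_rootIdeal, rootSpace_le_rootSubspace_iff]

lemma finrank_eq_card_idealRoots {𝔞 : LieIdeal ℂ (borel b)} (h𝔞 : IsLieAbelian 𝔞) :
    Module.finrank ℂ 𝔞 = (idealRoots 𝔞).card := by
  rw [← finrank_idealSubspace, idealSubspace_eq_rootSubspace h𝔞, finrank_rootSubspace]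

/-- An abelian ideal of `𝔟` is determined by its weight. -/
lemma idealRoots_eq_of_idealWeight_eq {𝔞 : LieIdeal ℂ (borel b)} (h𝔞 : IsLieAbelian 𝔞)
    {Φ : Finset H.root} (hpos : ∀ φ ∈ Φ, b.IsPos φ) (hup : IsUpwardClosed b Φ)
    (h : idealWeight b 𝔞 = ∑ φ ∈ Φ, rootVec φ) : idealRoots 𝔞 = Φ := by
  rw [idealWeight_eq_sum] at h
  exact (subset_of_sum_rootVec_eq (fun φ hφ => isPos_of_mem_idealRoots h𝔞 hφ)
    (isUpwardClosed_idealRoots 𝔞) hup h).antisymm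
    (subset_of_sum_rootVec_eq hpos hup (isUpwardClosed_idealRoots 𝔞) h.symm)

variable {σ : realCartan H ≃ᵃ[ℝ] realCartan H}

variable (b σ) in
/-- The positive roots `φ` such that the wall `(φ,x) = 1` separates `A_σ` from the fundamental
alcove. -/
def crossedRoots : Finset H.root := (posRoots b).filter fun φ => wallCount b σ φ = 1

lemma mem_crossedRoots_iff (hσ : σ ∈ truncatedElements b 2) {φ : H.root} (hφ : b.IsPos φ) :
    φ ∈ crossedRoots b σ ↔ 1 ≤ killForm H (rootVec φ) (σ ((2 : ℝ) • rho b)) := by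
  have h1 := (mem_truncatedElements_two_iff hσ.1).mp hσ φ hφ
  have h2 : 1 ≤ wallCount b σ φ ↔ ((1 : ℤ) : ℝ) ≤ killForm H (rootVec φ) (σ ((2 : ℝ) • rho b)) :=
    Int.le_floor
  rw [Int.cast_one] at h2
  rw [crossedRoots, Finset.mem_filter, mem_posRoots, ← h2, and_iff_right hφ]
  lia

lemma isPos_of_mem_crossedRoots {φ : H.root} (hφ : φ ∈ crossedRoots b σ) : b.IsPos φ :=
  mem_posRoots.mp (Finset.mem_filter.mp hφ).1

lemma isUpwardClosed_crossedRoots (hσ : σ ∈ truncatedElements b 2) :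
    IsUpwardClosed b (crossedRoots b σ) := by
  intro φ hφ α γ hα hγ
  have hφpos := isPos_of_mem_crossedRoots hφ
  have hγpos : b.IsPos γ := hα.add hφpos (rootVec_eq_add_iff.mp hγ)
  rw [mem_crossedRoots_iff hσ hφpos] at hφ
  rw [mem_crossedRoots_iff hσ hγpos, hγ, map_add, LinearMap.add_apply]
  linarith [killForm_map_two_rho_nonneg hσ.1 hα]

/-- Two values at least 1 at σ(2ρ) add up to at least 2, whereas wall counts are at most 1. -/
lemma rootVec_ne_add_of_mem_crossedRoots (hσ : σ ∈ truncatedElements b 2) :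
    ∀ φ ∈ crossedRoots b σ, ∀ χ ∈ crossedRoots b σ, ∀ γ : H.root,
      rootVec γ ≠ rootVec φ + rootVec χ := by
  intro φ hφ χ hχ γ hγ
  have hφpos := isPos_of_mem_crossedRoots hφ
  have hχpos := isPos_of_mem_crossedRoots hχ
  have hγpos : b.IsPos γ := hφpos.add hχpos (rootVec_eq_add_iff.mp hγ)
  rw [mem_crossedRoots_iff hσ hφpos] at hφ
  rw [mem_crossedRoots_iff hσ hχpos] at hχ
  have h1 := (mem_truncatedElements_two_iff hσ.1).mp hσ γ hγpos
  have h2 : (2 : ℤ) ≤ wallCount b σ γ := by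
    rw [wallCount, Int.le_floor, hγ, map_add, LinearMap.add_apply]
    push_cast
    linarith
  lia

lemma wallCount_eq_ite (hσ : σ ∈ truncatedElements b 2) {φ : H.root} (hφ : b.IsPos φ) :
    wallCount b σ φ = if wallCount b σ φ = 1 then 1 else 0 := by
  have h1 := (mem_truncatedElements_two_iff hσ.1).mp hσ φ hφ
  have h2 := wallCount_nonneg hσ.1 hφ
  split_ifs <;> lia

lemma alcoveWeight_eq_sum_crossedRoots (hσ : σ ∈ truncatedElements b 2) :
    alcoveWeight b σ = ∑ φ ∈ crossedRoots b σ, rootVec φ := by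
  rw [alcoveWeight_eq_sum hσ.1.1, crossedRoots, Finset.sum_filter]
  refine Finset.sum_congr rfl fun φ hφ => ?_
  rw [wallCount_eq_ite hσ (mem_posRoots.mp hφ)]
  split_ifs <;> simp_all

lemma length_eq_card_crossedRoots (hσ : σ ∈ truncatedElements b 2) :
    length b σ = (crossedRoots b σ).card := by
  have h := length_eq_sum_wallCount hσ.1
  rw [Finset.sum_congr rfl fun φ hφ => wallCount_eq_ite hσ (mem_posRoots.mp hφ),
    Finset.sum_boole] at h
  exact_mod_cast h

lemma existsUnique_abelian_ideal (hσ : σ ∈ truncatedElements b 2) :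
    ∃! 𝔞 : LieIdeal ℂ (borel b), IsLieAbelian 𝔞 ∧ idealWeight b 𝔞 = alcoveWeight b σ := by
  have hpos : ∀ φ ∈ crossedRoots b σ, b.IsPos φ := fun φ => isPos_of_mem_crossedRoots
  have hup := isUpwardClosed_crossedRoots hσ
  refine ⟨rootIdeal _ hpos hup,
    ⟨isLieAbelian_rootIdeal hpos hup (rootVec_ne_add_of_mem_crossedRoots hσ), ?_⟩, ?_⟩
  · rw [idealWeight_eq_sum, idealRoots_rootIdeal, alcoveWeight_eq_sum_crossedRoots hσ]
  · rintro 𝔞 ⟨h𝔞, h⟩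
    apply idealSubspace_injective
    rw [alcoveWeight_eq_sum_crossedRoots hσ] at h
    rw [idealSubspace_rootIdeal, idealSubspace_eq_rootSubspace h𝔞,
      idealRoots_eq_of_idealWeight_eq h𝔞 hpos hup h]

lemma length_eq_finrank (hσ : σ ∈ truncatedElements b 2) {𝔞 : LieIdeal ℂ (borel b)}
    (h𝔞 : IsLieAbelian 𝔞) (h : idealWeight b 𝔞 = alcoveWeight b σ) :
    length b σ = Module.finrank ℂ 𝔞 := by
  rw [alcoveWeight_eq_sum_crossedRoots hσ] at h
  rw [length_eq_card_crossedRoots hσ, finrank_eq_card_idealRoots h𝔞,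
    idealRoots_eq_of_idealWeight_eq h𝔞 (fun φ => isPos_of_mem_crossedRoots)
      (isUpwardClosed_crossedRoots hσ) h]

end

/-! ### The action of the Casimir element on a highest weight module -/

section

variable {M V : Type*} [AddCommGroup M] [Module ℂ M]
  [AddCommGroup V] [Module ℂ V] [LieRingModule 𝔤 V] [LieModule ℂ 𝔤 V]
variable {ι κ : Type*} [Fintype ι] [Fintype κ]

/-- The families `u` and `u'` are dual to each other, in the sense that `z = ∑ⱼ (z, u'ⱼ) uⱼ` for
all `z`. -/
def IsDualFamily (u u' : ι → 𝔤) : Prop := ∀ z, ∑ j, killingForm ℂ 𝔤 z (u' j) • u j = z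

/-- This is the invariance of the tensor Σ uᵢ ⊗ u'ᵢ, tested on a bilinear map F. It follows from the
invariance of the Killing form. -/
lemma IsDualFamily.sum_lie_add_sum_lie {u u' : ι → 𝔤} (h : IsDualFamily u u')
    (h' : IsDualFamily u' u) (F : 𝔤 →ₗ[ℂ] 𝔤 →ₗ[ℂ] M) (y : 𝔤) :
    ∑ i, F ⁅y, u i⁆ (u' i) + ∑ i, F (u i) ⁅y, u' i⁆ = 0 := by
  have h1 : ∑ i, F ⁅y, u i⁆ (u' i) =
      ∑ i, ∑ j, killingForm ℂ 𝔤 ⁅y, u i⁆ (u' j) • F (u j) (u' i) := by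
    refine Finset.sum_congr rfl fun i _ => ?_
    conv_lhs => rw [← h ⁅y, u i⁆]
    simp only [map_sum, map_smul, LinearMap.sum_apply, LinearMap.smul_apply]
  have h2 : ∑ j, F (u j) ⁅y, u' j⁆ =
      ∑ j, ∑ i, killingForm ℂ 𝔤 ⁅y, u' j⁆ (u i) • F (u j) (u' i) := by
    refine Finset.sum_congr rfl fun j _ => ?_
    conv_lhs => rw [← h' ⁅y, u' j⁆]
    simp only [map_sum, map_smul]
  rw [h1, h2, Finset.sum_comm, ← Finset.sum_add_distrib]
  refine Finset.sum_eq_zero fun j _ => ?_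
  rw [← Finset.sum_add_distrib]
  refine Finset.sum_eq_zero fun i _ => ?_
  rw [← add_smul, LieModule.traceForm_apply_lie_apply', LieModule.traceForm_comm ℂ 𝔤 𝔤 (u i),
    neg_add_cancel, zero_smul]

/-- The tensor Σ uᵢ ⊗ u'ᵢ does not depend on the dual families, so the Casimir operator may be
computed with root vectors. -/
lemma IsDualFamily.sum_eq_sum {u u' : ι → 𝔤} {w w' : κ → 𝔤} (hu : IsDualFamily u u')
    (hw : IsDualFamily w' w) (F : 𝔤 →ₗ[ℂ] 𝔤 →ₗ[ℂ] M) :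
    ∑ i, F (w i) (w' i) = ∑ j, F (u j) (u' j) := by
  have h1 : ∑ i, F (w i) (w' i) =
      ∑ i, ∑ j, killingForm ℂ 𝔤 (w i) (u' j) • F (u j) (w' i) := by
    refine Finset.sum_congr rfl fun i _ => ?_
    conv_lhs => rw [← hu (w i)]
    simp only [map_sum, map_smul, LinearMap.sum_apply, LinearMap.smul_apply]
  have h2 : ∑ j, F (u j) (u' j) =
      ∑ j, ∑ i, killingForm ℂ 𝔤 (u' j) (w i) • F (u j) (w' i) := by
    refine Finset.sum_congr rfl fun j _ => ?_
    conv_lhs => rw [← hw (u' j)]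
    simp only [map_sum, map_smul]
  rw [h1, h2, Finset.sum_comm]
  exact Finset.sum_congr rfl fun j _ => Finset.sum_congr rfl fun i _ => by
    rw [LieModule.traceForm_comm]

lemma isDualFamily_dualBasis [DecidableEq ι] (x : Module.Basis ι ℂ 𝔤) :
    IsDualFamily ((killingForm ℂ 𝔤).dualBasis (killingForm_nondegenerate ℂ 𝔤) x) x := fun z => by
  conv_rhs => rw [← ((killingForm ℂ 𝔤).dualBasis (killingForm_nondegenerate ℂ 𝔤) x).sum_repr z]
  simp only [LinearMap.BilinForm.dualBasis_repr_apply]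

lemma isDualFamily_self_dualBasis [DecidableEq ι] (x : Module.Basis ι ℂ 𝔤) :
    IsDualFamily x ((killingForm ℂ 𝔤).dualBasis (killingForm_nondegenerate ℂ 𝔤) x) := by
  have h := isDualFamily_dualBasis
    ((killingForm ℂ 𝔤).dualBasis (killingForm_nondegenerate ℂ 𝔤) x)
  rwa [LinearMap.BilinForm.dualBasis_dualBasis _ ⟨LieModule.traceForm_comm ℂ 𝔤 𝔤⟩] at h

variable (𝔤 V) in
/-- The operator by which the Casimir element acts on `V`. -/
def casimirEnd : Module.End ℂ V :=
  UniversalEnvelopingAlgebra.lift ℂ (LieModule.toEnd ℂ 𝔤 V) (casimirElement 𝔤)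

/-- The bilinear map `(x, y) ↦ x y v`. -/
def lieLie (v : V) : 𝔤 →ₗ[ℂ] 𝔤 →ₗ[ℂ] V :=
  LinearMap.mk₂ ℂ (fun x y => ⁅x, ⁅y, v⁆⁆) (by simp) (by simp) (by simp) (by simp)

lemma lieLie_apply (v : V) (x y : 𝔤) : lieLie v x y = ⁅x, ⁅y, v⁆⁆ := rfl

lemma casimirEnd_apply (v : V) :
    casimirEnd 𝔤 V v = ∑ i, lieLie v (Module.finBasis ℂ 𝔤 i) ((killingForm ℂ 𝔤).dualBasis
      (killingForm_nondegenerate ℂ 𝔤) (Module.finBasis ℂ 𝔤) i) := by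
  simp only [casimirEnd, casimirElement, map_sum, map_mul, UniversalEnvelopingAlgebra.lift_ι_apply,
    LinearMap.sum_apply, Module.End.mul_apply, LieModule.toEnd_apply_apply, lieLie_apply]

lemma IsDualFamily.casimirEnd_apply {u u' : ι → 𝔤} (h : IsDualFamily u u') (v : V) :
    casimirEnd 𝔤 V v = ∑ j, ⁅u j, ⁅u' j, v⁆⁆ := by
  rw [Alcove.casimirEnd_apply, h.sum_eq_sum (isDualFamily_dualBasis _)]
  rfl

lemma casimirEnd_lie (y : 𝔤) (v : V) : casimirEnd 𝔤 V ⁅y, v⁆ = ⁅y, casimirEnd 𝔤 V v⁆ := by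
  have h := isDualFamily_self_dualBasis (Module.finBasis ℂ 𝔤)
  have h1 := h.sum_lie_add_sum_lie (isDualFamily_dualBasis _) (lieLie v) y
  rw [h.casimirEnd_apply, h.casimirEnd_apply, lie_sum, ← sub_eq_zero, ← neg_eq_zero, ← h1,
    ← Finset.sum_sub_distrib, ← Finset.sum_neg_distrib, ← Finset.sum_add_distrib]
  refine Finset.sum_congr rfl fun i _ => ?_
  simp only [lieLie_apply, lie_lie, lie_sub]
  abel

/-- The elements of a basis of the Cartan subalgebra and the root vectors. -/
def rootFamily : Fin (Module.finrank ℂ H) ⊕ H.root → 𝔤 :=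
  Sum.elim (fun i => (Module.finBasis ℂ H i : 𝔤)) rootElt

variable (H) in
/-- The basis of the Cartan subalgebra dual to the chosen one. -/
def cartanDualBasis : Module.Basis (Fin (Module.finrank ℂ H)) ℂ H :=
  (LieModule.traceForm ℂ H 𝔤).dualBasis (traceForm_cartan_nondegenerate ℂ 𝔤 H)
    (Module.finBasis ℂ H)

/-- The family dual to `rootFamily`. -/
def rootDualFamily : Fin (Module.finrank ℂ H) ⊕ H.root → 𝔤 :=
  Sum.elim (fun i => (cartanDualBasis H i : 𝔤))
    (fun φ => (killingForm ℂ 𝔤 (rootElt φ) (rootElt (-φ)))⁻¹ • rootElt (-φ))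

lemma sum_killingForm_cartanDualBasis_smul (h : H) :
    ∑ i, killingForm ℂ 𝔤 (h : 𝔤) (cartanDualBasis H i : 𝔤) • Module.finBasis ℂ H i = h := by
  have hB := traceForm_cartan_nondegenerate ℂ 𝔤 H
  have h1 := (Module.finBasis ℂ H).sum_repr h
  have h2 : (LieModule.traceForm ℂ H 𝔤).dualBasis hB (cartanDualBasis H) = Module.finBasis ℂ H :=
    LinearMap.BilinForm.dualBasis_dualBasis hB ⟨LieModule.traceForm_comm ℂ H 𝔤⟩ _
  conv_rhs => rw [← h1]
  refine Finset.sum_congr rfl fun i _ => ?_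
  conv_rhs => enter [1]; rw [← h2, LinearMap.BilinForm.dualBasis_repr_apply]
  rfl

lemma killingForm_rootElt_eq_zero {φ χ : H.root} (h : χ ≠ -φ) :
    killingForm ℂ 𝔤 (rootElt φ) (rootElt χ) = 0 := by
  refine killingForm_apply_eq_zero_of_mem_rootSpace_of_add_ne_zero ℂ 𝔤 H (rootElt_mem φ)
    (rootElt_mem χ) fun h0 => h ((rootSystem H).root.injective ?_)
  rw [root_neg]
  ext x
  exact eq_neg_of_add_eq_zero_right (congrFun h0 x)

lemma killingForm_coe_rootElt (h : H) (φ : H.root) :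
    killingForm ℂ 𝔤 (h : 𝔤) (rootElt φ) = 0 := by
  have h1 : (h : 𝔤) ∈ rootSpace H (0 : H → ℂ) := by
    rw [rootSpace_zero_eq]
    exact h.2
  refine killingForm_apply_eq_zero_of_mem_rootSpace_of_add_ne_zero ℂ 𝔤 H h1 (rootElt_mem φ) ?_
  rw [zero_add]
  exact LieSubalgebra.isNonZero_coe_root φ

/-- Both sides are linear in z, so it suffices to take z in the Cartan subalgebra or z a root
vector; root spaces are orthogonal unless their roots are opposite. -/
lemma isDualFamily_rootFamily : IsDualFamily (rootFamily (H := H)) rootDualFamily := by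
  let T : 𝔤 →ₗ[ℂ] 𝔤 :=
    ∑ j, ((killingForm ℂ 𝔤).flip (rootDualFamily (H := H) j)).smulRight (rootFamily j)
  have hT : ∀ z, T z = ∑ j, killingForm ℂ 𝔤 z (rootDualFamily (H := H) j) • rootFamily j := by
    simp [T]
  suffices h : LinearMap.eqLocus T LinearMap.id = ⊤ from fun z => by
    rw [← hT]
    exact LinearMap.mem_eqLocus.mp (h ▸ Submodule.mem_top : z ∈ LinearMap.eqLocus T LinearMap.id)
  rw [eq_top_iff, ← LieSubmodule.top_toSubmodule (R := ℂ) (L := H) (M := 𝔤),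
    ← cartan_sup_iSup_rootSpace_eq_top, LieSubmodule.sup_toSubmodule]
  refine sup_le (fun h hh => ?_) ?_
  · rw [LinearMap.mem_eqLocus, hT, Fintype.sum_sum_type, LinearMap.id_apply]
    have h1 := congrArg (fun x : H => (x : 𝔤)) (sum_killingForm_cartanDualBasis_smul ⟨h, hh⟩)
    simp only [AddSubmonoidClass.coe_finsetSum, SetLike.val_smul] at h1
    simp only [rootDualFamily, rootFamily, Sum.elim_inl, Sum.elim_inr, map_smul, smul_eq_mul,
      killingForm_coe_rootElt ⟨h, hh⟩, mul_zero, zero_smul, Finset.sum_const_zero, add_zero, h1]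
  · simp only [LieSubmodule.iSup_toSubmodule]
    refine iSup₂_le fun α hα => ?_
    let φ : H.root := ⟨α, by simpa using hα⟩
    refine (rootSpace_le_iff (φ := φ)).mpr ?_
    rw [LinearMap.mem_eqLocus, hT, Fintype.sum_sum_type, LinearMap.id_apply,
      Finset.sum_eq_zero, zero_add, Finset.sum_eq_single φ]
    · simp only [rootDualFamily, rootFamily, Sum.elim_inr, map_smul, smul_eq_mul]
      rw [inv_mul_cancel₀ (killingForm_rootElt_rootElt_neg_ne_zero φ), one_smul]
    · intro χ _ hχ
      simp only [rootDualFamily, rootFamily, Sum.elim_inr, map_smul, smul_eq_mul]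
      rw [killingForm_rootElt_eq_zero fun h => hχ (neg_injective h), mul_zero, zero_smul]
    · simp
    · intro i _
      simp only [rootDualFamily, rootFamily, Sum.elim_inl]
      rw [LieModule.traceForm_comm, killingForm_coe_rootElt, zero_smul]

section HighestWeight

variable {b : (rootSystem H).Base} {μ : realCartan H} {v : V}

lemma sum_lie_lie_cartan
    (hv : ∀ h : H, ⁅(h : 𝔤), v⁆ = killingForm ℂ 𝔤 ((μ : H) : 𝔤) (h : 𝔤) • v) :
    ∑ i, ⁅(Module.finBasis ℂ H i : 𝔤), ⁅(cartanDualBasis H i : 𝔤), v⁆⁆ =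
      (killForm H μ μ : ℂ) • v := by
  have h1 := congrArg (fun x : H => killingForm ℂ 𝔤 ((μ : H) : 𝔤) (x : 𝔤))
    (sum_killingForm_cartanDualBasis_smul (μ : H))
  simp only [AddSubmonoidClass.coe_finsetSum, SetLike.val_smul, map_sum, map_smul,
    smul_eq_mul] at h1
  rw [coe_killForm, ← h1, Finset.sum_smul]
  refine Finset.sum_congr rfl fun i _ => ?_
  rw [hv, lie_smul, hv, smul_smul]

/-- For positive φ, e_φ kills v, so e_φ e_{−φ} v = [e_φ, e_{−φ}] v, which gives (μ, φ) v after
normalization. For negative φ already e_{−φ} kills v. -/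
lemma sum_lie_lie_rootElt
    (hv : ∀ h : H, ⁅(h : 𝔤), v⁆ = killingForm ℂ 𝔤 ((μ : H) : 𝔤) (h : 𝔤) • v)
    (hv' : ∀ α : H.root, b.IsPos α → ∀ e ∈ rootSpace H α.1, ⁅e, v⁆ = 0) :
    ∑ φ : H.root, ⁅rootElt φ,
        ⁅(killingForm ℂ 𝔤 (rootElt φ) (rootElt (-φ)))⁻¹ • rootElt (-φ), v⁆⁆ =
      (killForm H μ ((2 : ℝ) • rho b) : ℂ) • v := by
  have h1 : ∀ φ : H.root, b.IsPos φ → ⁅rootElt φ,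
      ⁅(killingForm ℂ 𝔤 (rootElt φ) (rootElt (-φ)))⁻¹ • rootElt (-φ), v⁆⁆ =
        (killForm H μ (rootVec φ) : ℂ) • v := by
    intro φ hφ
    rw [leibniz_lie, hv' φ hφ _ (rootElt_mem φ), lie_zero, add_zero, lie_smul,
      lie_rootElt_rootElt_neg, smul_smul,
      inv_mul_cancel₀ (killingForm_rootElt_rootElt_neg_ne_zero φ), one_smul, hv, coe_killForm]
  have h2 : ∀ φ : H.root, ¬ b.IsPos φ → ⁅rootElt φ,
      ⁅(killingForm ℂ 𝔤 (rootElt φ) (rootElt (-φ)))⁻¹ • rootElt (-φ), v⁆⁆ = 0 := by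
    intro φ hφ
    rw [← isPos_neg_iff] at hφ
    rw [smul_lie, hv' _ hφ _ (rootElt_mem _), smul_zero, lie_zero]
  rw [two_smul_rho, map_sum, Complex.ofReal_sum, Finset.sum_smul, posRoots, Finset.sum_filter]
  refine Finset.sum_congr rfl fun φ _ => ?_
  split_ifs with h
  · exact h1 φ h
  · exact h2 φ h

lemma cas_eq : cas b μ = killForm H μ μ + killForm H μ ((2 : ℝ) • rho b) := by
  rw [cas, map_smul, map_add, map_add, LinearMap.add_apply, LinearMap.add_apply,
    killForm_comm (rho b) μ, smul_eq_mul]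
  ring

/-- The action of the Casimir element on a highest weight vector. -/
lemma casimirEnd_apply_of_highestWeight
    (hv : ∀ h : H, ⁅(h : 𝔤), v⁆ = killingForm ℂ 𝔤 ((μ : H) : 𝔤) (h : 𝔤) • v)
    (hv' : ∀ α : H.root, b.IsPos α → ∀ e ∈ rootSpace H α.1, ⁅e, v⁆ = 0) :
    casimirEnd 𝔤 V v = (cas b μ : ℂ) • v := by
  rw [(isDualFamily_rootFamily (H := H)).casimirEnd_apply, Fintype.sum_sum_type, cas_eq,
    Complex.ofReal_add, add_smul, ← sum_lie_lie_cartan hv, ← sum_lie_lie_rootElt hv hv']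
  rfl

/-- The Casimir element acts on an irreducible module of highest weight `μ` as `Cas(μ)`. -/
lemma casimirEnd_eq_algebraMap [LieModule.IsIrreducible ℂ 𝔤 V] (h : HasHighestWeight b V μ) :
    casimirEnd 𝔤 V = algebraMap ℂ (Module.End ℂ V) (cas b μ) := by
  obtain ⟨v, hv0, hv, hv'⟩ := h
  -- The vectors on which the Casimir element acts by the given scalar form a submodule, because it
  -- commutes with 𝔤; this submodule contains v, hence is all of V.
  let N : LieSubmodule ℂ 𝔤 V :=
    { LinearMap.eqLocus (casimirEnd 𝔤 V) (algebraMap ℂ (Module.End ℂ V) (cas b μ)) with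
      lie_mem := fun {y w} hw => by
        have hw' : casimirEnd 𝔤 V w = (cas b μ : ℂ) • w := hw
        change casimirEnd 𝔤 V ⁅y, w⁆ = (cas b μ : ℂ) • ⁅y, w⁆
        rw [casimirEnd_lie, hw', lie_smul] }
  have hvN : v ∈ N := casimirEnd_apply_of_highestWeight hv hv'
  have hN : N = ⊤ := (eq_bot_or_eq_top N).resolve_left fun h =>
    hv0 ((LieSubmodule.mem_bot v).mp (h ▸ hvN))
  ext w
  exact (hN ▸ LieSubmodule.mem_top w : w ∈ N)

end HighestWeight

end

end Alcove

end

open Alcove in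
theorem theorem4p5 {𝔤 : Type*} [LieRing 𝔤] [LieAlgebra ℂ 𝔤] [FiniteDimensional ℂ 𝔤]
    [LieAlgebra.IsSimple ℂ 𝔤] (H : LieSubalgebra ℂ 𝔤) [H.IsCartanSubalgebra]
    (b : (LieAlgebra.IsKilling.rootSystem H).Base)
    (σ : realCartan H ≃ᵃ[ℝ] realCartan H) (hσ : σ ∈ dominantElements b) :
    (∀ (V : Type*) [AddCommGroup V] [Module ℂ V] [LieRingModule 𝔤 V] [LieModule ℂ 𝔤 V]
      [FiniteDimensional ℂ V] [LieModule.IsIrreducible ℂ 𝔤 V],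
      HasHighestWeight b V (alcoveWeight b σ) →
        UniversalEnvelopingAlgebra.lift ℂ (LieModule.toEnd ℂ 𝔤 V) (casimirElement 𝔤) =
          algebraMap ℂ (Module.End ℂ V) (cas b (alcoveWeight b σ))) ∧
    (length b σ : ℝ) ≤ cas b (alcoveWeight b σ) ∧
    (cas b (alcoveWeight b σ) = length b σ ↔ σ ∈ truncatedElements b 2) ∧
    (σ ∈ truncatedElements b 2 →
      (∃! 𝔞 : LieIdeal ℂ (borel b), IsLieAbelian 𝔞 ∧ idealWeight b 𝔞 = alcoveWeight b σ) ∧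
      ∀ 𝔞 : LieIdeal ℂ (borel b), IsLieAbelian 𝔞 → idealWeight b 𝔞 = alcoveWeight b σ →
        cas b (alcoveWeight b σ) = length b σ ∧ length b σ = Module.finrank ℂ 𝔞) := by
  refine ⟨fun V => ?_, length_le_cas hσ, cas_eq_length_iff hσ, fun h => ?_⟩
  · intro _ _ _ _ _ _ hV
    exact casimirEnd_eq_algebraMap hV
  · exact ⟨existsUnique_abelian_ideal h, fun 𝔞 h𝔞 hw =>
      ⟨(cas_eq_length_iff hσ).mpr h, length_eq_finrank h h𝔞 hw⟩⟩
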